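/- Let $\Sigma$ be a proper CAT(0) space with metric $d$. Let $\mathcal B$ be a treelike block decomposition of $\Sigma$. This means the following. * $\mathcal B$ is a collection of closed convex subsets of $\Sigma$ (the *blocks*) whose union is $\Sigma$. * The adjacency graph $\mathcal T$ is a simplicial tree. Its vertices are the blocks, and its edges are the pairs of distinct blocks with non-empty intersection. * The *walls* are the non-empty intersections $B_1\cap B_2$ of two distinct blocks. There is $d_{\mathcal W}>0$ such that $\inf_{x_1\in W_1,\,x_2\in W_2}d(x_1,x_2)\ge d_{\mathcal W}$ for any two distinct walls $W_1,W_2$. For a geodesic segment $\gamma:[a,b]\to\Sigma$ that does not start in a wall, the *itinerary* $I(\gamma)$ is the shortest path in $\mathcal T$ without repeated vertices that links the unique block containing $\gamma(a)$ with one of the blocks containing $\gamma(b)$. A geodesic ray $\gamma:[0,\infty)\to\Sigma$ (an isometric embedding) that does not start in a wall has *infinite itinerary* if there are no block $B$ and time $t_0$ with $\gamma(t)\in B$ for all $t\ge t_0$. In this case its itinerary $I(\gamma)$ is the infinite path $(B_1,B_2,\dots)$ in $\mathcal T$ for which there are times $0=t_0<t_1<t_2<\cdots$ such that, for every $i\ge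 1$, $I(\gamma|_{[0,t_i]})=(B_1,\dots,B_i)$ and $\gamma(t_i)$ lies in $B_i$ but in no wall. A map $\sigma:[a,b]\to\Sigma$ is a $(K,L)$-*quasi-geodesic* if $\frac1K|s-t|-L\le d(\sigma(s),\sigma(t))\le K|s-t|+L$ for all $s,t\in[a,b]$. A geodesic ray $\gamma$ is *Morse* if there is a function $M:[1,\infty)\times[0,\infty)\to[0,\infty)$ such that for all $K\ge1$ and $L\ge0$ every $(K,L)$-quasi-geodesic with endpoints on $\gamma$ is contained in the $M(K,L)$-neighbourhood of $\gamma$. **Proposition (loneliness property).** Let $p\in\Sigma$ be a point that does not lie in a wall. Let $\alpha\ne\beta$ be two geodesic rays in $\Sigma$ with $\alpha(0)=\beta(0)=p$ that both have infinite itinerary. If at least one of $\alpha$ and $\beta$ is Morse, then the itineraries $I(\alpha)$ and $I(\beta)$ (which exist and are unique) are different: $I(\alpha)\neq I(\beta)$. -/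

import Mathlib

open scoped NNReal

namespace BlockDecomp

section Geodesics

variable {X : Type*} [MetricSpace X]

/-- `c`, restricted to `[0, dist x y]`, is a geodesic segment from `x` to `y`. -/
structure IsGeodesicSegment (c : ℝ → X) (x y : X) : Prop where
  source : c 0 = x
  target : c (dist x y) = y
  isometric : ∀ s ∈ Set.Icc 0 (dist x y), ∀ t ∈ Set.Icc 0 (dist x y), dist (c s) (c t) = |s - t|

variable (X) in
/-- A CAT(0) space: a geodesic metric space whose geodesic triangles are not thicker than their
comparison triangles in the Euclidean plane. Two points on different sides of a triangle lie on two
sides that issue from a common vertex `p`, and for two points on the same side the comparison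
inequality is trivial, so the two sides `[p, q]` and `[p, r]` of an arbitrarily labelled triangle
suffice. -/
structure IsCAT0 : Prop where
  geodesic : ∀ x y : X, ∃ c : ℝ → X, IsGeodesicSegment c x y
  comparison : ∀ (p q r : X) (c₁ c₂ : ℝ → X),
    IsGeodesicSegment c₁ p q → IsGeodesicSegment c₂ p r →
    ∀ p' q' r' : EuclideanSpace ℝ (Fin 2),
      dist p' q' = dist p q → dist p' r' = dist p r → dist q' r' = dist q r →
    ∀ s ∈ Set.Icc 0 (dist p q), ∀ t ∈ Set.Icc 0 (dist p r),
    ∀ x' ∈ segment ℝ p' q', ∀ y' ∈ segment ℝ p' r', dist p' x' = s → dist p' y' = t →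
      dist (c₁ s) (c₂ t) ≤ dist x' y'

/-- A subset that contains every geodesic segment joining two of its points. -/
def IsGeodesicallyConvex (C : Set X) : Prop :=
  ∀ x ∈ C, ∀ y ∈ C, ∀ c : ℝ → X, IsGeodesicSegment c x y →
    ∀ s ∈ Set.Icc 0 (dist x y), c s ∈ C

/-- A geodesic ray is an isometric embedding of `[0, ∞)`. -/
def IsGeodesicRay (γ : ℝ≥0 → X) : Prop := Isometry γ

/-- `σ`, restricted to `[a, b]`, is a `(K, L)`-quasi-geodesic (not necessarily continuous). -/
def IsQuasiGeodesic (K L a b : ℝ) (σ : ℝ → X) : Prop :=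
  ∀ s ∈ Set.Icc a b, ∀ t ∈ Set.Icc a b,
    K⁻¹ * |s - t| - L ≤ dist (σ s) (σ t) ∧ dist (σ s) (σ t) ≤ K * |s - t| + L

/-- The ray `γ` is `M`-Morse: for `K ≥ 1` and `L ≥ 0`, every `(K, L)`-quasi-geodesic with endpoints
on `γ` lies in the `M K L`-neighbourhood of `γ`. -/
def IsMorseWith (M : ℝ → ℝ → ℝ≥0) (γ : ℝ≥0 → X) : Prop :=
  ∀ K L : ℝ, 1 ≤ K → 0 ≤ L → ∀ (a b : ℝ) (σ : ℝ → X), a ≤ b → IsQuasiGeodesic K L a b σ →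
    σ a ∈ Set.range γ → σ b ∈ Set.range γ →
      ∀ s ∈ Set.Icc a b, σ s ∈ Metric.thickening (M K L) (Set.range γ)

/-- The ray `γ` is Morse if it is `M`-Morse for some Morse gauge `M`. -/
def IsMorse (γ : ℝ≥0 → X) : Prop := ∃ M : ℝ → ℝ → ℝ≥0, IsMorseWith M γ

end Geodesics

section Blocks

variable {X : Type*} [MetricSpace X]

/-- A collection of closed convex subsets (the blocks) that covers the space. -/
structure IsBlockDecomposition (𝓑 : Set (Set X)) : Prop where
  isClosed : ∀ B ∈ 𝓑, IsClosed B
  convex : ∀ B ∈ 𝓑, IsGeodesicallyConvex B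
  covers : ⋃₀ 𝓑 = Set.univ

/-- The walls: the non-empty intersections of two distinct blocks. -/
def walls (𝓑 : Set (Set X)) : Set (Set X) :=
  {W | ∃ B₁ ∈ 𝓑, ∃ B₂ ∈ 𝓑, B₁ ≠ B₂ ∧ W = B₁ ∩ B₂ ∧ W.Nonempty}

/-- The adjacency graph: its vertices are the blocks, and two distinct blocks are joined by an edge
if and only if they intersect. -/
def adjacencyGraph (𝓑 : Set (Set X)) : SimpleGraph 𝓑 where
  Adj B C := B ≠ C ∧ ((B : Set X) ∩ (C : Set X)).Nonempty
  symm := ⟨fun _ _ h => ⟨h.1.symm, by rw [Set.inter_comm]; exact h.2⟩⟩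
  loopless := ⟨fun _ h => h.1 rfl⟩

/-- A block decomposition is treelike if its adjacency graph is a tree and if any two distinct walls
have distance (the infimum of the distances of their points) at least some `d > 0`. -/
structure IsTreelike (𝓑 : Set (Set X)) : Prop extends IsBlockDecomposition 𝓑 where
  isTree : (adjacencyGraph 𝓑).IsTree
  separating : ∃ d : ℝ, 0 < d ∧ ∀ W₁ ∈ walls 𝓑, ∀ W₂ ∈ walls 𝓑, W₁ ≠ W₂ →
    ∀ x₁ ∈ W₁, ∀ x₂ ∈ W₂, d ≤ dist x₁ x₂

/-- The block `B` without the walls that it contains. -/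
def openBlock (𝓑 : Set (Set X)) (B : Set X) : Set X :=
  B \ ⋃₀ {W ∈ walls 𝓑 | W ⊆ B}

/-- `P` is the itinerary of the geodesic segment from `x` (a point outside the walls) to `y`: a
shortest one among the geodesic paths, i.e. the paths without repeated vertices, of the adjacency
graph that link the block containing `x` with a block containing `y`. -/
structure IsSegmentItinerary (𝓑 : Set (Set X)) (x y : X) {B C : 𝓑}
    (P : (adjacencyGraph 𝓑).Walk B C) : Prop where
  source_mem : x ∈ (B : Set X)
  target_mem : y ∈ (C : Set X)
  isPath : P.IsPath
  shortest : ∀ (C' : 𝓑) (Q : (adjacencyGraph 𝓑).Walk B C'), y ∈ (C' : Set X) → Q.IsPath →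
    P.length ≤ Q.length

/-- The ray `γ` ends in a block: from some time on it stays in one and the same block. -/
def EndsInBlock (𝓑 : Set (Set X)) (γ : ℝ≥0 → X) : Prop :=
  ∃ B ∈ 𝓑, ∃ t₀ : ℝ≥0, ∀ t, t₀ ≤ t → γ t ∈ B

/-- A ray that starts outside the walls has infinite itinerary if it does not end in a block. -/
def HasInfiniteItinerary (𝓑 : Set (Set X)) (γ : ℝ≥0 → X) : Prop := ¬ EndsInBlock 𝓑 γ

/-- The infinite itinerary of a ray `γ` that does not end in a block is the path of the adjacency
graph with the successive vertices `I 0, I 1, I 2, …` such that, for certain times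
`0 = t 0 < t 1 < t 2 < …`, the itinerary of `γ` restricted to `[0, t (i + 1)]` is the path with the
successive vertices `I 0, …, I i`, and `γ (t (i + 1))` lies in `I i` but in no wall. (The edges of
the path, that is its walls, are determined by its vertices.) -/
def IsInfiniteItinerary (𝓑 : Set (Set X)) (γ : ℝ≥0 → X) (I : ℕ → 𝓑) : Prop :=
  HasInfiniteItinerary 𝓑 γ ∧
  ∃ t : ℕ → ℝ≥0, t 0 = 0 ∧ StrictMono t ∧
    ∀ i : ℕ, γ (t (i + 1)) ∈ openBlock 𝓑 (I i) ∧
      ∃ P : (adjacencyGraph 𝓑).Walk (I 0) (I i),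
        IsSegmentItinerary 𝓑 (γ 0) (γ (t (i + 1))) P ∧
          P.support = (List.range (i + 1)).map I

end Blocks

end BlockDecomp

open scoped NNReal

namespace BlockDecomp

/-! ### Comparison geometry of CAT(0) spaces and the Morse condition. -/

section CAT0

variable {X : Type*} [MetricSpace X]

/-! Suppose that both rays have the itinerary $(B_1,B_2,\dots)$. Both then cross every wall
$W_i=B_i\cap B_{i+1}$, and by convexity a segment joining a point of `α` to a point of `β` in $W_i$
stays in $W_i$. If `α` is Morse, all segments from `α` to `β` meet one fixed ball around $p$
(`IsMorseWith.exists_bound`). So this ball meets every $W_i$. These walls are distinct, hence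
pairwise at distance at least $d_{\mathcal W}$, which is impossible in a compact ball
(`IsInfiniteItinerary.false_of_bounded`).

The fixed ball comes from an angle argument. On a segment from `α` to `β`, the point nearest to $p$
lies within `M 3 0` of some `α u`, because a geodesic turned at a nearest point is a
$(3,0)$-quasi-geodesic. Applied to large triangles, this shows that some comparison angle of the
rays at $p$ exceeds $\pi/2$ (`IsMorseWith.exists_obtuse`). Comparison angles increase along the
rays, so the law of cosines then bounds $u$.

The combinatorial half shows that each ray moves monotonically away from the root of the tree.
Cutting the tree at an edge splits $\Sigma$ into two unions of blocks that meet only in the wall of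
that edge. Both must be closed for a ray to be forced through the wall. Local finiteness of the
blocks is not assumed; it is replaced by countability of the blocks, separation of the walls and
Sierpiński's theorem (`IsTreelike.exists_ball_block`). -/

/-- Put `q` on the first axis; the law of cosines gives the first coordinate of `r`. The comparison
axiom speaks about given comparison triangles, so it is usable only once one exists. -/
theorem exists_comparison_triangle {a b d : ℝ} (ha : 0 ≤ a) (hb : 0 ≤ b) (h₁ : d ≤ a + b)
    (h₂ : a ≤ b + d) (h₃ : b ≤ a + d) :
    ∃ q r : EuclideanSpace ℝ (Fin 2), ‖q‖ = a ∧ ‖r‖ = b ∧ dist q r = d := by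
  rcases ha.eq_or_lt with rfl | ha'
  · refine ⟨0, !₂[b, 0], by simp, ?_, ?_⟩
    · simp [EuclideanSpace.norm_eq, Real.sqrt_sq hb]
    · simp [EuclideanSpace.norm_eq, Real.sqrt_sq hb]
      linarith
  · set x := (a ^ 2 + b ^ 2 - d ^ 2) / (2 * a) with hx
    have hxa : 2 * a * x = a ^ 2 + b ^ 2 - d ^ 2 := by rw [hx]; field_simp
    have hx1 : x ≤ b := by
      rw [hx, div_le_iff₀ (by positivity)]; nlinarith
    have hx2 : -b ≤ x := by
      rw [hx, le_div_iff₀ (by positivity)]; nlinarith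
    have hxb : 0 ≤ b ^ 2 - x ^ 2 := by nlinarith
    have hs := Real.sq_sqrt hxb
    refine ⟨!₂[a, 0], !₂[x, √(b ^ 2 - x ^ 2)], ?_, ?_, ?_⟩
    · simp [EuclideanSpace.norm_eq, Real.sqrt_sq ha]
    · rw [EuclideanSpace.norm_eq, Real.sqrt_eq_iff_eq_sq (by positivity) hb]
      simp [Fin.sum_univ_two, hs]
    · rw [EuclideanSpace.dist_eq, Real.sqrt_eq_iff_eq_sq (by positivity) (by linarith)]
      simp [Fin.sum_univ_two, Real.dist_eq, hs]
      linarith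

/-- The CAT(0) comparison inequality in terms of the law of cosines. -/
theorem IsCAT0.dist_sq_le (hX : IsCAT0 X) {p q r : X} {c₁ c₂ : ℝ → X}
    (h₁ : IsGeodesicSegment c₁ p q) (h₂ : IsGeodesicSegment c₂ p r) {l m : ℝ}
    (hl : l ∈ Set.Icc (0 : ℝ) 1) (hm : m ∈ Set.Icc (0 : ℝ) 1) :
    dist (c₁ (l * dist p q)) (c₂ (m * dist p r)) ^ 2 ≤
      l ^ 2 * dist p q ^ 2 + m ^ 2 * dist p r ^ 2
        - l * m * (dist p q ^ 2 + dist p r ^ 2 - dist q r ^ 2) := by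
  obtain ⟨q', r', hq, hr, hqr⟩ := exists_comparison_triangle (a := dist p q) (b := dist p r)
    (d := dist q r) dist_nonneg dist_nonneg (by rw [dist_comm p q]; exact dist_triangle _ _ _)
    (by rw [dist_comm q r]; exact dist_triangle _ _ _) (dist_triangle _ _ _)
  have key := hX.comparison p q r c₁ c₂ h₁ h₂ 0 q' r' (by simpa using hq) (by simpa using hr) hqr
    (l * dist p q) ⟨mul_nonneg hl.1 dist_nonneg, mul_le_of_le_one_left dist_nonneg hl.2⟩
    (m * dist p r) ⟨mul_nonneg hm.1 dist_nonneg, mul_le_of_le_one_left dist_nonneg hm.2⟩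
    (l • q') ⟨1 - l, l, by linarith [hl.2], hl.1, by ring, by simp⟩
    (m • r') ⟨1 - m, m, by linarith [hm.2], hm.1, by ring, by simp⟩
    (by simp [norm_smul, abs_of_nonneg hl.1, hq]) (by simp [norm_smul, abs_of_nonneg hm.1, hr])
  have h3 : dist (l • q') (m • r') ^ 2 = l ^ 2 * dist p q ^ 2 + m ^ 2 * dist p r ^ 2
        - l * m * (dist p q ^ 2 + dist p r ^ 2 - dist q r ^ 2) := by
    have e := norm_sub_sq_real q' r'
    rw [← dist_eq_norm, hqr, hq, hr] at e
    rw [dist_eq_norm, norm_sub_sq_real, norm_smul, norm_smul, mul_pow, mul_pow, hq, hr,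
      real_inner_smul_left, real_inner_smul_right]
    simp only [Real.norm_eq_abs, sq_abs]
    linear_combination (- l * m) * e
  rw [← h3]
  exact pow_le_pow_left₀ dist_nonneg key 2

/-- Stewart's identity for the comparison triangle; at `τ = 1 / 2` it is the CN inequality. -/
theorem IsCAT0.dist_sq_segment_le (hX : IsCAT0 X) {a b : X} (p : X) {c : ℝ → X}
    (hc : IsGeodesicSegment c a b) {τ : ℝ} (hτ : τ ∈ Set.Icc (0 : ℝ) 1) :
    dist p (c (τ * dist a b)) ^ 2 ≤
      (1 - τ) * dist p a ^ 2 + τ * dist p b ^ 2 - τ * (1 - τ) * dist a b ^ 2 := by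
  obtain ⟨e, he⟩ := hX.geodesic a p
  have := hX.dist_sq_le hc he hτ (m := 1) ⟨by norm_num, le_rfl⟩
  rw [one_mul, he.target, dist_comm, dist_comm a p, dist_comm b p] at this
  linarith

theorem IsGeodesicRay.dist_eq {γ : ℝ≥0 → X} (hγ : IsGeodesicRay γ) (s t : ℝ≥0) :
    dist (γ s) (γ t) = |(s : ℝ) - t| := by
  rw [Isometry.dist_eq hγ, NNReal.dist_eq]

theorem IsGeodesicRay.isGeodesicSegment {γ : ℝ≥0 → X} (hγ : IsGeodesicRay γ) {s t : ℝ≥0}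
    (hst : s ≤ t) : IsGeodesicSegment (fun x : ℝ => γ (s + x.toNNReal)) (γ s) (γ t) := by
  have hst' : (s : ℝ) ≤ t := hst
  refine ⟨by simp, ?_, ?_⟩
  · congr 1
    rw [hγ.dist_eq]
    apply NNReal.coe_injective
    rw [NNReal.coe_add, Real.coe_toNNReal _ (abs_nonneg _), abs_of_nonpos (by linarith)]
    ring
  · intro x hx y hy
    rw [hγ.dist_eq, NNReal.coe_add, NNReal.coe_add, Real.coe_toNNReal _ hx.1,
      Real.coe_toNNReal _ hy.1]
    ring_nf

theorem IsGeodesicallyConvex.mem_of_mem_ray {C : Set X} (hC : IsGeodesicallyConvex C)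
    {γ : ℝ≥0 → X} (hγ : IsGeodesicRay γ) {s t u : ℝ≥0} (hs : γ s ∈ C) (ht : γ t ∈ C)
    (hsu : s ≤ u) (hut : u ≤ t) : γ u ∈ C := by
  have hsu' : (s : ℝ) ≤ u := hsu
  have hut' : (u : ℝ) ≤ t := hut
  have := hC _ hs _ ht _ (hγ.isGeodesicSegment (hsu.trans hut)) (u - s) (by
    rw [hγ.dist_eq, abs_of_nonpos (by linarith)]
    constructor <;> linarith)
  convert this using 2
  apply NNReal.coe_injective
  rw [NNReal.coe_add, Real.coe_toNNReal _ (by linarith)]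
  ring

/-- The comparison angle of two rays with common origin is monotone. -/
theorem IsCAT0.dist_sq_ray_mul_le (hX : IsCAT0 X) {α β : ℝ≥0 → X} (hα : IsGeodesicRay α)
    (hβ : IsGeodesicRay β) (h0 : α 0 = β 0) {r u v : ℝ≥0} (hr : 0 < r) (hu : r ≤ u) (hv : r ≤ v) :
    dist (α r) (β r) ^ 2 * (u * v) ≤
      (r : ℝ) ^ 2 * (dist (α u) (β v) ^ 2 - ((u : ℝ) - v) ^ 2) := by
  have hr' : (0 : ℝ) < r := hr
  have hu' : (r : ℝ) ≤ u := hu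
  have hv' : (r : ℝ) ≤ v := hv
  have hu0 : (0 : ℝ) < u := by linarith
  have hv0 : (0 : ℝ) < v := by linarith
  have h1 := hα.isGeodesicSegment (zero_le (a := u))
  have h2 := hβ.isGeodesicSegment (zero_le (a := v))
  rw [← h0] at h2
  have key := hX.dist_sq_le h1 h2 (l := r / u) (m := r / v)
    ⟨by positivity, by rw [div_le_one hu0]; exact hu'⟩
    ⟨by positivity, by rw [div_le_one hv0]; exact hv'⟩
  have e1 : dist (α 0) (α u) = u := by rw [hα.dist_eq]; simp
  have e2 : dist (α 0) (β v) = v := by rw [h0, hβ.dist_eq]; simp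
  rw [e1, e2, div_mul_cancel₀ _ hu0.ne', div_mul_cancel₀ _ hv0.ne'] at key
  simp only [zero_add, Real.toNNReal_coe] at key
  calc dist (α r) (β r) ^ 2 * (u * v) ≤ _ := mul_le_mul_of_nonneg_right key (by positivity)
    _ = _ := by field_simp; ring

theorem IsGeodesicSegment.dist_left {c : ℝ → X} {a b : X} (hc : IsGeodesicSegment c a b) {t : ℝ}
    (ht : t ∈ Set.Icc 0 (dist a b)) : dist a (c t) = t := by
  conv_lhs => rw [← hc.source]
  rw [hc.isometric 0 ⟨le_rfl, dist_nonneg⟩ t ht, zero_sub, abs_neg, abs_of_nonneg ht.1]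

theorem IsGeodesicSegment.dist_right {c : ℝ → X} {a b : X} (hc : IsGeodesicSegment c a b) {t : ℝ}
    (ht : t ∈ Set.Icc 0 (dist a b)) : dist (c t) b = dist a b - t := by
  conv_lhs => rw [← hc.target]
  rw [hc.isometric t ht _ ⟨dist_nonneg, le_rfl⟩, abs_of_nonpos (by linarith [ht.2])]
  ring

theorem IsGeodesicSegment.drop {c : ℝ → X} {a b : X} (hc : IsGeodesicSegment c a b) {τ : ℝ}
    (hτ : τ ∈ Set.Icc 0 (dist a b)) : IsGeodesicSegment (fun x => c (τ + x)) (c τ) b := by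
  refine ⟨by simp, ?_, fun x hx y hy => ?_⟩
  · rw [hc.dist_right hτ, add_sub_cancel, hc.target]
  · rw [hc.dist_right hτ] at hx hy
    rw [hc.isometric _ ⟨by linarith [hx.1, hτ.1], by linarith [hx.2]⟩ _
      ⟨by linarith [hy.1, hτ.1], by linarith [hy.2]⟩]
    ring_nf

theorem IsGeodesicSegment.continuousOn {c : ℝ → X} {a b : X} (hc : IsGeodesicSegment c a b) :
    ContinuousOn c (Set.Icc 0 (dist a b)) := by
  have : LipschitzOnWith 1 c (Set.Icc 0 (dist a b)) :=
    LipschitzOnWith.of_dist_le_mul fun s hs t ht => by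
      rw [hc.isometric s hs t ht, Real.dist_eq]; simp
  exact this.continuousOn

theorem IsGeodesicSegment.exists_nearest {c : ℝ → X} {a b : X} (hc : IsGeodesicSegment c a b)
    (p : X) : ∃ τ ∈ Set.Icc 0 (dist a b), ∀ s ∈ Set.Icc 0 (dist a b),
      dist p (c τ) ≤ dist p (c s) :=
  isCompact_Icc.exists_isMinOn ⟨0, le_rfl, dist_nonneg⟩
    (continuous_const.dist continuous_id |>.comp_continuousOn hc.continuousOn)

/-- The angle at a nearest point is at least $\pi/2$, so the side opposite to it is the longest. -/
theorem IsCAT0.dist_nearest_le (hX : IsCAT0 X) {c : ℝ → X} {a b p : X}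
    (hc : IsGeodesicSegment c a b)
    (hmin : ∀ s ∈ Set.Icc 0 (dist a b), dist p a ≤ dist p (c s)) : dist a b ≤ dist p b := by
  by_contra! h
  have hb : 0 < dist a b := dist_nonneg.trans_lt h
  have hsq : dist p b ^ 2 < dist a b ^ 2 := pow_lt_pow_left₀ h dist_nonneg two_ne_zero
  -- Any positive parameter below `1 - dist p b ^ 2 / dist a b ^ 2` would give a point closer to `p`
  -- than `a`; this is half of that bound.
  set y := (dist a b ^ 2 - dist p b ^ 2) / (2 * dist a b ^ 2) with hy
  have hy0 : 0 < y := div_pos (by linarith) (by positivity)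
  have hyab : y * (2 * dist a b ^ 2) = dist a b ^ 2 - dist p b ^ 2 := by
    rw [hy]; field_simp
  have hy1 : y ≤ 1 := by
    rw [hy, div_le_one (by positivity)]; linarith [sq_nonneg (dist a b), sq_nonneg (dist p b)]
  have h1 := hX.dist_sq_segment_le p hc (τ := y) ⟨hy0.le, hy1⟩
  have h2 := pow_le_pow_left₀ dist_nonneg (hmin (y * dist a b)
    ⟨by positivity, mul_le_of_le_one_left hb.le hy1⟩) 2
  have h3 : y * ((1 - y) * dist a b ^ 2) ≤ y * (dist p b ^ 2 - dist p a ^ 2) := by linarith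
  have h4 := le_of_mul_le_mul_left h3 hy0
  linarith [sq_nonneg (dist p a)]

/-- A segment followed by a shortest segment from one of its points to `p` is a
`(3, 0)`-quasi-geodesic. -/
theorem isQuasiGeodesic_concat {c e : ℝ → X} {a b p : X} (hc : IsGeodesicSegment c a b) {τ : ℝ}
    (hτ : τ ∈ Set.Icc 0 (dist a b))
    (hmin : ∀ s ∈ Set.Icc 0 (dist a b), dist p (c τ) ≤ dist p (c s))
    (he : IsGeodesicSegment e (c τ) p) :
    IsQuasiGeodesic 3 0 0 (τ + dist (c τ) p) (fun x => if x ≤ τ then c x else e (x - τ)) := by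
  have main : ∀ s t : ℝ, 0 ≤ s → s ≤ τ → τ ≤ t → t ≤ τ + dist (c τ) p →
      (3 : ℝ)⁻¹ * |s - t| - 0 ≤ dist (c s) (e (t - τ)) ∧
        dist (c s) (e (t - τ)) ≤ 3 * |s - t| + 0 := by
    intro s t hs hsτ hτt ht
    have hs' : s ∈ Set.Icc 0 (dist a b) := ⟨hs, hsτ.trans hτ.2⟩
    have ht' : t - τ ∈ Set.Icc 0 (dist (c τ) p) := ⟨by linarith, by linarith⟩
    have h1 := he.dist_left ht'
    have h2 := he.dist_right ht'
    have h3 := hc.isometric s hs' τ hτ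
    -- Minimality gives `t - τ ≤ dist (c s) (e (t - τ))`, hence `τ - s` is at most twice that
    -- distance. This is the source of the constant 3.
    have h4 := hmin s hs'
    have h5 := dist_triangle (c s) (e (t - τ)) p
    have h6 := dist_triangle (c s) (e (t - τ)) (c τ)
    have h7 := dist_triangle (c s) (c τ) (e (t - τ))
    rw [dist_comm (e (t - τ)) (c τ)] at h6
    rw [dist_comm p (c s), dist_comm p (c τ)] at h4
    rw [abs_of_nonpos (by linarith)] at h3 ⊢
    constructor <;> linarith
  intro s hs t ht
  by_cases hsτ : s ≤ τ <;> by_cases htτ : t ≤ τ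
  · simp only [hsτ, htτ, if_true]
    rw [hc.isometric s ⟨hs.1, hsτ.trans hτ.2⟩ t ⟨ht.1, htτ.trans hτ.2⟩]
    constructor <;> linarith [abs_nonneg (s - t)]
  · simp only [hsτ, htτ, if_true, if_false]
    exact main s t hs.1 hsτ (le_of_not_ge htτ) ht.2
  · simp only [hsτ, htτ, if_true, if_false]
    rw [dist_comm, abs_sub_comm]
    exact main t s ht.1 htτ (le_of_not_ge hsτ) hs.2
  · simp only [hsτ, htτ, if_false]
    push Not at hsτ htτ
    rw [he.isometric (s - τ) ⟨by linarith, by linarith [hs.2]⟩ (t - τ)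
      ⟨by linarith, by linarith [ht.2]⟩, sub_sub_sub_cancel_right]
    constructor <;> linarith [abs_nonneg (s - t)]

/-- On a segment issuing from a Morse ray, the point nearest to the origin of the ray is uniformly
close to the ray. -/
theorem IsMorseWith.exists_nearest_close (hX : IsCAT0 X) {α : ℝ≥0 → X} {M : ℝ → ℝ → ℝ≥0}
    (hM : IsMorseWith M α) {s : ℝ≥0} {b : X} {c : ℝ → X} (hc : IsGeodesicSegment c (α s) b) :
    ∃ τ ∈ Set.Icc 0 (dist (α s) b), (∀ t ∈ Set.Icc 0 (dist (α s) b),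
      dist (α 0) (c τ) ≤ dist (α 0) (c t)) ∧ ∃ u, dist (c τ) (α u) < M 3 0 := by
  obtain ⟨τ, hτ, hmin⟩ := hc.exists_nearest (α 0)
  obtain ⟨e, he⟩ := hX.geodesic (c τ) (α 0)
  refine ⟨τ, hτ, hmin, ?_⟩
  have := hM 3 0 (by norm_num) le_rfl _ _ _ (add_nonneg hτ.1 dist_nonneg)
    (isQuasiGeodesic_concat hc hτ hmin he) (by simp [hτ.1, hc.source]) (by
      by_cases h : dist (c τ) (α 0) ≤ 0
      · have h' : dist (c τ) (α 0) = 0 := le_antisymm h dist_nonneg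
        simp only [h', add_zero, le_refl, if_true]
        exact ⟨0, (dist_eq_zero.1 h').symm⟩
      · simp only [add_le_iff_nonpos_right, h, if_false, add_sub_cancel_left, he.target]
        exact ⟨0, rfl⟩)
    τ ⟨hτ.1, by linarith [dist_nonneg (x := c τ) (y := α 0)]⟩
  simp only [le_refl, if_true] at this
  obtain ⟨_, ⟨u, rfl⟩, hu⟩ := Metric.mem_thickening_iff.1 this
  exact ⟨u, hu⟩

end CAT0
-- Two rays, one of them Morse: an obtuse angle and a common ball.
section Divergence

variable {X : Type*} [MetricSpace X]

/-- The Euclidean estimate that excludes the angle of two rays from being at most `π / 2`. -/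
theorem false_of_slim_triangle {c c₁ δ M R u D G H : ℝ} (hc : 0 < c) (hc2 : c ≤ 3 / 2)
    (hδ : δ = c ^ 2 / 2048) (hc₁ : c₁ = c - δ) (hR : 0 < R)
    (hMR : 2 * M ≤ δ * R) (hMR' : 16 * M ≤ c₁ ^ 2 * R) (hGc : G ≤ c * R) (hGc₁ : c₁ * R ≤ G)
    (hD : D ^ 2 ≤ R ^ 2 - G ^ 2 / 4) (huD : u ≤ D + M) (hG : R - u + H - 2 * M ≤ G)
    (hH0 : 0 ≤ H) (hH : (R - u) ^ 2 + u * R * c₁ ^ 2 ≤ H ^ 2) : False := by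
  have hδ0 : 0 < δ := by rw [hδ]; positivity
  have hδc : δ ≤ c / 1000 := by rw [hδ]; nlinarith
  have hc₁0 : c / 2 ≤ c₁ := by rw [hc₁]; linarith
  have hc₁pos : 0 < c₁ := by linarith
  have hc₁2 : c₁ ≤ 3 / 2 := by linarith
  have hDle : D ≤ R * (1 - c₁ ^ 2 / 8) := by
    have h1 : (c₁ * R) ^ 2 ≤ G ^ 2 := pow_le_pow_left₀ (by positivity) hGc₁ 2
    have h2 : D ^ 2 ≤ (R * (1 - c₁ ^ 2 / 8)) ^ 2 := by
      have : 0 ≤ R ^ 2 * c₁ ^ 4 := by positivity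
      nlinarith
    exact le_of_sq_le_sq h2 (mul_nonneg hR.le (by nlinarith))
  -- The midpoint estimate puts `D` at least `R * c₁ ^ 2 / 8` below `R`, and `M` uses up at most
  -- half of this gap.
  have hu : R * c₁ ^ 2 / 16 ≤ R - u := by linarith
  set E := (c + δ) * R with hE
  have h3 : H ≤ E - (R - u) := by rw [hE]; linarith
  have h4 : H ^ 2 ≤ (E - (R - u)) ^ 2 := pow_le_pow_left₀ hH0 h3 2
  -- The squares `(R - u) ^ 2` cancel, which leaves an inequality linear in `R - u`.
  have h5 : (R - u) * (2 * E - R * c₁ ^ 2) ≤ E ^ 2 - R ^ 2 * c₁ ^ 2 := by nlinarith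
  have h6 : R * c₁ / 2 ≤ 2 * E - R * c₁ ^ 2 := by
    have : c₁ / 2 ≤ 2 * (c + δ) - c₁ ^ 2 := by nlinarith
    have := mul_le_mul_of_nonneg_left this hR.le
    rw [hE]; linarith
  have h7 : (R * c₁ ^ 2 / 16) * (R * c₁ / 2) ≤ (R - u) * (2 * E - R * c₁ ^ 2) :=
    mul_le_mul hu h6 (by positivity) (le_trans (by positivity) hu)
  have h8 : R ^ 2 * (c₁ ^ 3 / 32) ≤ R ^ 2 * ((c + δ) ^ 2 - c₁ ^ 2) := by
    rw [hE] at h5 h7; linarith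
  have h9 := le_of_mul_le_mul_left h8 (by positivity)
  have h10 : (c / 2) ^ 3 ≤ c₁ ^ 3 := pow_le_pow_left₀ (by positivity) hc₁0 3
  -- The choice of `δ`: the right side `4 * c * δ = c ^ 3 / 512` is smaller than `c₁ ^ 3 / 32 ≥ c ^
  -- 3 / 256`.
  have h11 : (c + δ) ^ 2 - c₁ ^ 2 = c ^ 3 / 512 := by rw [hc₁, hδ]; ring
  have : 0 < c ^ 3 := by positivity
  linarith

theorem IsCAT0.dist_ray_mul_le (hX : IsCAT0 X) {α β : ℝ≥0 → X} (hα : IsGeodesicRay α)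
    (hβ : IsGeodesicRay β) (h0 : α 0 = β 0) {r u : ℝ≥0} (hr : 0 < r) (hu : r ≤ u) :
    dist (α r) (β r) * u ≤ r * dist (α u) (β u) := by
  have := hX.dist_sq_ray_mul_le hα hβ h0 hr hu hu
  refine le_of_sq_le_sq ?_ (by positivity)
  rw [sub_self] at this
  linarith

/-- Otherwise the chord ratio `dist (α t) (β t) / t` is at most $\sqrt2$; it is nondecreasing, so it
is almost constant for large `t`. In a large triangle the base then passes near a point `α u` with
`u` well below `R`, so the detour through `α u` costs only a bounded amount, whereas almost
Euclidean comparison makes it cost an amount proportional to `R`. -/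
theorem IsMorseWith.exists_obtuse (hX : IsCAT0 X) {α β : ℝ≥0 → X} {M : ℝ → ℝ → ℝ≥0}
    (hM : IsMorseWith M α) (hα : IsGeodesicRay α) (hβ : IsGeodesicRay β) (h0 : α 0 = β 0)
    (hne : α ≠ β) : ∃ t : ℝ≥0, 0 < t ∧ 2 * (t : ℝ) ^ 2 < dist (α t) (β t) ^ 2 := by
  by_contra! hcon
  obtain ⟨t₁, ht₁⟩ := Function.ne_iff.1 hne
  have ht₁0 : 0 < t₁ := by
    rw [pos_iff_ne_zero]; rintro rfl; exact ht₁ h0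
  set F : Set.Ioi (0 : ℝ≥0) → ℝ := fun t => dist (α t) (β t) / (t : ℝ≥0) with hF
  have hFle : ∀ t, F t ≤ 3 / 2 := fun ⟨t, ht⟩ => by
    have ht' : (0 : ℝ) < t := ht
    simp only [hF]
    rw [div_le_iff₀ ht']
    refine le_of_sq_le_sq ((hcon t ht).trans ?_) (by positivity)
    nlinarith
  have hbdd : BddAbove (Set.range F) := ⟨3 / 2, by rintro _ ⟨t, rfl⟩; exact hFle t⟩
  have : Nonempty (Set.Ioi (0 : ℝ≥0)) := ⟨⟨t₁, ht₁0⟩⟩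
  set c := ⨆ t, F t with hc
  have hFc : ∀ t, F t ≤ c := fun t => le_ciSup hbdd t
  have hc0 : 0 < c := by
    refine lt_of_lt_of_le ?_ (hFc ⟨t₁, ht₁0⟩)
    exact div_pos (dist_pos.2 ht₁) ht₁0
  have hc2 : c ≤ 3 / 2 := ciSup_le hFle
  obtain ⟨δ, hδ⟩ : ∃ δ, δ = c ^ 2 / 2048 := ⟨_, rfl⟩
  have hδ0 : 0 < δ := by rw [hδ]; positivity
  have hδc : δ ≤ c / 1000 := by rw [hδ]; nlinarith
  obtain ⟨⟨T, hT⟩, hFT⟩ := exists_lt_of_lt_ciSup (show c - δ < c by linarith)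
  have hT' : (0 : ℝ) < T := hT
  obtain ⟨c₁, hc₁⟩ : ∃ c₁, c₁ = c - δ := ⟨_, rfl⟩
  have hc₁0 : 0 < c₁ := by linarith
  have hgT : c₁ * T ≤ dist (α T) (β T) := by
    rw [← hc₁, hF, lt_div_iff₀ hT'] at hFT
    exact hFT.le
  have hg1 : ∀ t, T ≤ t → c₁ * t ≤ dist (α t) (β t) := fun t ht => by
    have := hX.dist_ray_mul_le hα hβ h0 hT ht
    refine le_of_mul_le_mul_left ?_ hT'
    nlinarith [t.coe_nonneg]
  have hg2 : ∀ t : ℝ≥0, 0 < t → dist (α t) (β t) ≤ c * t := fun t ht => by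
    have := hFc ⟨t, ht⟩
    rwa [hF, div_le_iff₀ (show (0 : ℝ) < t from ht)] at this
  set m : ℝ := ((M 3 0 : ℝ≥0) : ℝ) with hm
  have hm0 : 0 ≤ m := (M 3 0).coe_nonneg
  obtain ⟨R, hRT, hR1, hR2, hR3⟩ : ∃ R : ℝ≥0, (T : ℝ) ≤ R ∧ 4 * (T + m) < R ∧ 2 * m ≤ δ * R ∧
      16 * m ≤ c₁ ^ 2 * R := by
    refine ⟨⟨T + 4 * (T + m) + 2 * m / δ + 16 * m / c₁ ^ 2, by positivity⟩, ?_, ?_, ?_, ?_⟩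
    · show (T : ℝ) ≤ T + 4 * (T + m) + 2 * m / δ + 16 * m / c₁ ^ 2
      have : 0 ≤ 4 * (T + m) + 2 * m / δ + 16 * m / c₁ ^ 2 := by positivity
      linarith
    · show 4 * (T + m) < T + 4 * (T + m) + 2 * m / δ + 16 * m / c₁ ^ 2
      have : 0 < T + 2 * m / δ + 16 * m / c₁ ^ 2 := by positivity
      linarith
    · show 2 * m ≤ δ * (T + 4 * (T + m) + 2 * m / δ + 16 * m / c₁ ^ 2)
      have h1 : δ * (2 * m / δ) = 2 * m := by field_simp
      have h2 : 0 ≤ δ * (T + 4 * (T + m) + 16 * m / c₁ ^ 2) := by positivity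
      linarith
    · show 16 * m ≤ c₁ ^ 2 * (T + 4 * (T + m) + 2 * m / δ + 16 * m / c₁ ^ 2)
      have h1 : c₁ ^ 2 * (16 * m / c₁ ^ 2) = 16 * m := by field_simp
      have h2 : 0 ≤ c₁ ^ 2 * (T + 4 * (T + m) + 2 * m / δ) := by positivity
      linarith
  have hR0 : (0 : ℝ) < R := by linarith
  obtain ⟨e, he⟩ := hX.geodesic (α R) (β R)
  obtain ⟨τ, hτ, hmin, u, hu⟩ := hM.exists_nearest_close hX he
  set D := dist (α 0) (e τ)
  set G := dist (α R) (β R)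
  set H := dist (α u) (β R)
  have hαR : dist (α 0) (α R) = R := by rw [hα.dist_eq]; simp
  have hβR : dist (α 0) (β R) = R := by rw [h0, hβ.dist_eq]; simp
  have hαu : dist (α 0) (α u) = u := by rw [hα.dist_eq]; simp
  have hD : D ^ 2 ≤ (R : ℝ) ^ 2 - G ^ 2 / 4 := by
    have h1 := hX.dist_sq_segment_le (α 0) he (τ := 1 / 2) (by constructor <;> norm_num)
    have h2 := hmin (1 / 2 * G) ⟨by positivity, by linarith [dist_nonneg (x := α R) (y := β R)]⟩
    have h3 := pow_le_pow_left₀ dist_nonneg h2 2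
    rw [hαR, hβR] at h1
    linarith
  have hu' : dist (e τ) (α u) ≤ m := hu.le
  have huD : (u : ℝ) ≤ D + m := by
    linarith [dist_triangle (α 0) (e τ) (α u)]
  have hG : (R : ℝ) - u + H - 2 * m ≤ G := by
    have h1 := he.dist_left hτ
    have h2 := he.dist_right hτ
    have h3 := dist_triangle (α R) (e τ) (α u)
    have h4 := dist_triangle (α u) (e τ) (β R)
    have h5 : (R : ℝ) - u ≤ dist (α R) (α u) := by
      rw [hα.dist_eq]; exact le_abs_self _
    rw [dist_comm (α u) (e τ)] at h4
    linarith
  have hG2 : G ≤ c * R := hg2 R hR0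
  -- Monotonicity of the angle from `T` on needs `T ≤ u`. If `u < T`, the base passes near the
  -- common origin and is longer than `3 / 2 * R`, since `4 * (T + m) < R`.
  by_cases huT : T ≤ u
  · refine false_of_slim_triangle hc0 hc2 hδ hc₁ hR0 hR2 hR3 hG2 (hg1 R hRT) hD huD hG
      dist_nonneg ?_
    have h1 := hX.dist_sq_ray_mul_le hα hβ h0 hT huT hRT
    have h2 := pow_le_pow_left₀ (by positivity) hgT 2
    have h3 := mul_le_mul_of_nonneg_right h2 (show (0 : ℝ) ≤ u * R by positivity)
    have h4 : (T : ℝ) ^ 2 * (c₁ ^ 2 * (u * R)) ≤ (T : ℝ) ^ 2 * (H ^ 2 - ((u : ℝ) - R) ^ 2) := by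
      linarith
    have h5 := le_of_mul_le_mul_left h4 (by positivity)
    linarith
  · have huT' : (u : ℝ) < T := lt_of_not_ge huT
    have hH : (R : ℝ) - u ≤ H := by
      linarith [dist_triangle (α 0) (α u) (β R)]
    nlinarith

/-- All segments between two different rays with common origin, one of which is Morse, pass through
a fixed ball. -/
theorem IsMorseWith.exists_bound (hX : IsCAT0 X) {α β : ℝ≥0 → X} {M : ℝ → ℝ → ℝ≥0}
    (hM : IsMorseWith M α) (hα : IsGeodesicRay α) (hβ : IsGeodesicRay β) (h0 : α 0 = β 0)
    (hne : α ≠ β) : ∃ ρ : ℝ, ∀ (s v : ℝ≥0) (c : ℝ → X), IsGeodesicSegment c (α s) (β v) →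
      ∃ τ ∈ Set.Icc 0 (dist (α s) (β v)), dist (α 0) (c τ) ≤ ρ := by
  obtain ⟨t, ht, hobt⟩ := hM.exists_obtuse hX hα hβ h0 hne
  have ht' : (0 : ℝ) < t := ht
  set m : ℝ := ((M 3 0 : ℝ≥0) : ℝ) with hm
  have hm0 : 0 ≤ m := (M 3 0).coe_nonneg
  obtain ⟨ε, hε, hεt⟩ : ∃ ε : ℝ, 0 < ε ∧ (2 + ε) * (t : ℝ) ^ 2 = dist (α t) (β t) ^ 2 := by
    refine ⟨dist (α t) (β t) ^ 2 / t ^ 2 - 2, ?_, by field_simp; ring⟩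
    rw [sub_pos, lt_div_iff₀ (by positivity)]
    exact hobt
  refine ⟨t + m + 2 * m / ε + m, fun s v c hc => ?_⟩
  obtain ⟨τ, hτ, hmin, u, hu⟩ := hM.exists_nearest_close hX hc
  refine ⟨τ, hτ, ?_⟩
  have hu' : dist (c τ) (α u) ≤ m := hu.le
  have hpos : 0 ≤ 2 * m / ε := by positivity
  have hβv : dist (α 0) (β v) = v := by rw [h0, hβ.dist_eq]; simp
  have hαu : dist (α 0) (α u) = u := by rw [hα.dist_eq]; simp
  by_cases hv : t ≤ v
  swap
  · have h1 := hmin _ ⟨dist_nonneg, le_rfl⟩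
    have h2 : (v : ℝ) < t := lt_of_not_ge hv
    rw [hc.target, hβv] at h1
    linarith
  have hDu : dist (α 0) (c τ) ≤ u + m := by
    have := dist_triangle (α 0) (α u) (c τ)
    rw [dist_comm (α u)] at this
    linarith
  by_cases hut : t ≤ u
  swap
  · have h2 : (u : ℝ) < t := lt_of_not_ge hut
    linarith
  set h := dist (c τ) (β v) with hh
  -- `c τ` is also nearest to the origin on the remaining segment, so the angle there is at least
  -- $\pi/2$.
  have hhv : h ≤ v := by
    rw [← hβv]
    refine hX.dist_nearest_le (hc.drop hτ) fun s hs => hmin _ ?_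
    rw [hc.dist_right hτ] at hs
    exact ⟨add_nonneg hτ.1 hs.1, by linarith [hs.2]⟩
  have h1 := hX.dist_sq_ray_mul_le hα hβ h0 ht hut hv
  rw [← hεt] at h1
  have h2 : (t : ℝ) ^ 2 * ((2 + ε) * (u * v)) ≤ t ^ 2 * (dist (α u) (β v) ^ 2 - ((u : ℝ) - v) ^ 2) := by
    linarith
  have h3 := le_of_mul_le_mul_left h2 (by positivity)
  have h4 : dist (α u) (β v) ≤ m + v := by
    have := dist_triangle (α u) (c τ) (β v)
    rw [dist_comm (α u) (c τ)] at this
    linarith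
  have h5 := pow_le_pow_left₀ dist_nonneg h4 2
  have hv0 : (0 : ℝ) < v := lt_of_lt_of_le ht' hv
  have h6 : (u : ℝ) ≤ m + 2 * m / ε := by
    -- The obtuse angle gives `u ^ 2 + v ^ 2 + ε * u * v ≤ (m + v) ^ 2`, which fails once `u > m`
    -- and `ε * u > 2 * m`.
    by_contra! hcon
    have h7 : m < u := by linarith
    have h8 : 2 * m < ε * u := by
      have : 2 * m / ε < u := by linarith
      rwa [div_lt_iff₀ hε, mul_comm (u : ℝ)] at this
    have h9 : 2 * m * v < ε * u * v := mul_lt_mul_of_pos_right h8 hv0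
    have h10 : m ^ 2 ≤ (u : ℝ) ^ 2 := pow_le_pow_left₀ hm0 h7.le 2
    nlinarith
  linarith

end Divergence
-- Countable closed partitions of the line.
section Sierpinski

/-- Sierpiński's theorem for the real line: it has no partition into at least two, but countably
many, closed sets. -/
theorem exists_eq_univ_of_countable_closed_partition {ι : Type*} [Countable ι] (F : ι → Set ℝ)
    (hF : ∀ i, IsClosed (F i)) (hdisj : ∀ i j x, x ∈ F i → x ∈ F j → i = j)
    (hcov : ∀ x, ∃ i, x ∈ F i) : ∃ i, F i = Set.univ := by
  have hEempty : ∀ x, ∃ i, x ∈ interior (F i) := by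
    by_contra! hne
    obtain ⟨x₀, hx₀⟩ := hne
    set E : Set ℝ := (⋃ i, interior (F i))ᶜ with hE
    have hEc : IsClosed E := (isOpen_iUnion fun i => isOpen_interior).isClosed_compl
    have hx₀E : x₀ ∈ E := by simpa [hE] using hx₀
    have : CompleteSpace E := hEc.completeSpace_coe
    have : Nonempty E := ⟨⟨x₀, hx₀E⟩⟩
    -- Baire's theorem in `E`: some `F i` contains all points of `E` near `e`. A nearby point of
    -- another `F j` would yield a frontier point of `F j` on the way to `e`; that point lies in
    -- `E`, hence in `F i`.
    obtain ⟨i, ⟨⟨e, heE⟩, hei⟩⟩ := nonempty_interior_of_iUnion_of_closed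
      (f := fun i => ((↑) : E → ℝ) ⁻¹' F i) (fun i => (hF i).preimage continuous_subtype_val)
      (by ext x; simpa using hcov x)
    obtain ⟨ε, hε, hball⟩ := Metric.mem_nhds_iff.1 (mem_interior_iff_mem_nhds.1 hei)
    have hEi : ∀ y ∈ E, |y - e| < ε → y ∈ F i := fun y hy hye =>
      hball (show (⟨y, hy⟩ : E) ∈ Metric.ball _ _ from hye)
    have heFi : e ∈ F i := hEi e heE (by simpa using hε)
    refine heE (Set.mem_iUnion.2 ⟨i, mem_interior_iff_mem_nhds.2
      (Metric.mem_nhds_iff.2 ⟨ε, hε, fun x hx => ?_⟩)⟩)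
    by_contra hxi
    obtain ⟨j, hxj⟩ := hcov x
    have hij : i ≠ j := by rintro rfl; exact hxi hxj
    have hej : e ∉ F j := fun h => hij (hdisj _ _ _ heFi h)
    have hfr : (Set.uIcc x e ∩ frontier (F j)).Nonempty := by
      by_contra hcon
      obtain ⟨y, -, hy1, hy2⟩ := isPreconnected_uIcc (interior (F j)) (F j)ᶜ isOpen_interior
        (hF j).isOpen_compl (fun y hy => by
          by_cases hyj : y ∈ F j
          · by_contra hyi
            exact hcon ⟨y, hy, subset_closure hyj, fun h => hyi (Or.inl h)⟩
          · exact Or.inr hyj)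
        ⟨x, Set.left_mem_uIcc, by
          by_contra hxi
          exact hcon ⟨x, Set.left_mem_uIcc, subset_closure hxj, hxi⟩⟩
        ⟨e, Set.right_mem_uIcc, hej⟩
      exact hy2 (interior_subset hy1)
    obtain ⟨y, hy, hyf⟩ := hfr
    have hyj : y ∈ F j := (hF j).frontier_subset hyf
    have hyE : y ∈ E := by
      rw [hE, Set.mem_compl_iff, Set.mem_iUnion]
      rintro ⟨k, hk⟩
      obtain rfl := hdisj _ _ _ hyj (interior_subset hk)
      exact hyf.2 hk
    refine hij (hdisj _ _ y (hEi y hyE ?_) hyj)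
    rw [abs_sub_comm]
    refine (Set.abs_sub_right_of_mem_uIcc hy).trans_lt ?_
    rw [abs_sub_comm]
    exact hx
  obtain ⟨i, hi⟩ := hEempty 0
  refine ⟨i, Set.eq_univ_iff_forall.2 fun x => ?_⟩
  have hclopen : IsClopen (F i) := by
    refine ⟨hF i, isOpen_iff_mem_nhds.2 fun x hx => ?_⟩
    obtain ⟨j, hj⟩ := hEempty x
    obtain rfl := hdisj _ _ _ hx (interior_subset hj)
    exact mem_interior_iff_mem_nhds.1 hj
  rw [(isClopen_iff.1 hclopen).resolve_left (Set.Nonempty.ne_empty ⟨0, interior_subset hi⟩)]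
  trivial

end Sierpinski

/-! ### Root paths in a tree; their prefix order is the ancestor order. -/

section Tree

variable {V : Type*} {G : SimpleGraph V}

/-- The vertices of the path that links the root `r` of a tree with `v`. -/
noncomputable def rootPath (hG : G.IsTree) (r v : V) : List V :=
  (hG.existsUnique_path r v).choose.support

theorem rootPath_eq (hG : G.IsTree) {r v : V} {P : G.Walk r v} (hP : P.IsPath) :
    rootPath hG r v = P.support := by
  rw [(hG.existsUnique_path r v).choose_spec.2 P hP, rootPath]

theorem exists_rootPath (hG : G.IsTree) (r v : V) :
    ∃ P : G.Walk r v, P.IsPath ∧ rootPath hG r v = P.support :=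
  ⟨_, (hG.existsUnique_path r v).choose_spec.1, rfl⟩

theorem rootPath_self (hG : G.IsTree) (r : V) : rootPath hG r r = [r] :=
  rootPath_eq hG SimpleGraph.Walk.IsPath.nil

theorem rootPath_ne_nil (hG : G.IsTree) (r v : V) : rootPath hG r v ≠ [] :=
  SimpleGraph.Walk.support_ne_nil _

theorem getLast_rootPath (hG : G.IsTree) (r v : V) :
    (rootPath hG r v).getLast (rootPath_ne_nil hG r v) = v :=
  SimpleGraph.Walk.getLast_support _

theorem rootPath_injective (hG : G.IsTree) (r : V) : Function.Injective (rootPath hG r) := by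
  intro v w h
  rw [← getLast_rootPath hG r v, ← getLast_rootPath hG r w]
  congr 1

theorem rootPath_of_adj (hG : G.IsTree) (r : V) {v w : V} (h : G.Adj v w) :
    rootPath hG r w = rootPath hG r v ++ [w] ∨ rootPath hG r v = rootPath hG r w ++ [v] := by
  obtain ⟨P, hP, hPe⟩ := exists_rootPath hG r v
  obtain ⟨Q, hQ, hQe⟩ := exists_rootPath hG r w
  by_cases hv : v ∈ Q.support
  · left
    rw [hPe, hQe, hG.isAcyclic.path_concat hP hQ h hv, SimpleGraph.Walk.support_concat]
  · right
    have hw := hG.isAcyclic.mem_support_of_ne_mem_support_of_adj_of_isPath hP hQ h hv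
    rw [hPe, hQe, hG.isAcyclic.path_concat hQ hP h.symm hw, SimpleGraph.Walk.support_concat]

theorem exists_parent (hG : G.IsTree) {r v : V} (h : v ≠ r) :
    ∃ w, G.Adj w v ∧ rootPath hG r v = rootPath hG r w ++ [v] := by
  obtain ⟨P, hP, hPe⟩ := exists_rootPath hG r v
  have hnil : ¬ P.Nil := fun hn => h hn.eq.symm
  refine ⟨P.penultimate, P.adj_penultimate hnil, ?_⟩
  rw [rootPath_eq hG hP.dropLast, hPe, SimpleGraph.Walk.support_dropLast_concat hnil]

theorem exists_ancestor (hG : G.IsTree) (r : V) (n : ℕ) :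
    ∀ v, n < (rootPath hG r v).length →
      ∃ w, rootPath hG r w <+: rootPath hG r v ∧ (rootPath hG r w).length = n + 1 := by
  intro v
  induction hk : (rootPath hG r v).length generalizing v with
  | zero => intro h; omega
  | succ k ih =>
    intro hn
    by_cases hkn : k = n
    · exact ⟨v, List.prefix_rfl, by omega⟩
    · have hvr : v ≠ r := by
        rintro rfl
        rw [rootPath_self] at hk
        simp at hk
        omega
      obtain ⟨w, -, hw⟩ := exists_parent hG hvr
      have hlen := congrArg List.length hw
      simp only [List.length_append, List.length_singleton] at hlen
      obtain ⟨z, hz, hzn⟩ := ih w (by omega) (by omega)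
      exact ⟨z, hz.trans (hw ▸ List.prefix_append _ _), hzn⟩

end Tree
-- Topology of the blocks and the two sides of a wall.
section Blocks

variable {X : Type*} {𝓑 : Set (Set X)}

/-- A point that lies in no wall. -/
def IsWallFree (𝓑 : Set (Set X)) (x : X) : Prop := ∀ W ∈ walls 𝓑, x ∉ W

theorem inter_mem_walls {A B : Set X} (hA : A ∈ 𝓑) (hB : B ∈ 𝓑) (hne : A ≠ B) {x : X}
    (hxA : x ∈ A) (hxB : x ∈ B) : A ∩ B ∈ walls 𝓑 :=
  ⟨A, hA, B, hB, hne, rfl, x, hxA, hxB⟩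

theorem IsWallFree.eq {x : X} (hx : IsWallFree 𝓑 x) {A B : 𝓑} (hA : x ∈ (A : Set X))
    (hB : x ∈ (B : Set X)) : A = B := by
  by_contra hne
  exact hx _ (inter_mem_walls A.2 B.2 (fun h => hne (Subtype.ext h)) hA hB) ⟨hA, hB⟩

theorem IsWallFree.mem_openBlock {x : X} (hx : IsWallFree 𝓑 x) {B : Set X} (hB : x ∈ B) :
    x ∈ openBlock 𝓑 B :=
  ⟨hB, fun ⟨W, hW, hxW⟩ => hx W hW.1 hxW⟩

variable [MetricSpace X]

theorem IsBlockDecomposition.exists_mem (h : IsBlockDecomposition 𝓑) (x : X) :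
    ∃ B : 𝓑, x ∈ (B : Set X) := by
  have : x ∈ ⋃₀ 𝓑 := by rw [h.covers]; trivial
  obtain ⟨B, hB, hx⟩ := this
  exact ⟨⟨B, hB⟩, hx⟩

theorem IsBlockDecomposition.isClosed_wall (h : IsBlockDecomposition 𝓑) {W : Set X}
    (hW : W ∈ walls 𝓑) : IsClosed W := by
  obtain ⟨A, hA, B, hB, -, rfl, -⟩ := hW
  exact (h.isClosed A hA).inter (h.isClosed B hB)

theorem IsGeodesicallyConvex.inter {A B : Set X} (hA : IsGeodesicallyConvex A)
    (hB : IsGeodesicallyConvex B) : IsGeodesicallyConvex (A ∩ B) :=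
  fun x hx y hy c hc s hs => ⟨hA x hx.1 y hy.1 c hc s hs, hB x hx.2 y hy.2 c hc s hs⟩

/-- Three distinct blocks with a common point would form a triangle in the tree. -/
theorem IsTreelike.eq_or_eq (h : IsTreelike 𝓑) {A B C : 𝓑} {x : X} (hA : x ∈ (A : Set X))
    (hB : x ∈ (B : Set X)) (hC : x ∈ (C : Set X)) : A = B ∨ A = C ∨ B = C := by
  classical
  by_contra! hcon
  obtain ⟨h1, h2, h3⟩ := hcon
  exact h.isTree.isAcyclic.cliqueFree le_rfl {A, B, C} (SimpleGraph.is3Clique_triple_iff.2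
    ⟨⟨h1, x, hA, hB⟩, ⟨h2, x, hA, hC⟩, ⟨h3, x, hB, hC⟩⟩)

/-- A wall determines the block at its far end, as seen from the root. -/
theorem IsTreelike.eq_of_mem_parent (h : IsTreelike 𝓑) {r C D C' D' : 𝓑} {x : X}
    (hp : rootPath h.isTree r C = rootPath h.isTree r D ++ [C])
    (hp' : rootPath h.isTree r C' = rootPath h.isTree r D' ++ [C'])
    (hC : x ∈ (C : Set X)) (hD : x ∈ (D : Set X)) (hC' : x ∈ (C' : Set X))
    (hD' : x ∈ (D' : Set X)) : C = C' := by
  by_contra hne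
  have l1 := congrArg List.length hp
  have l2 := congrArg List.length hp'
  simp only [List.length_append, List.length_singleton] at l1 l2
  have hCD : C ≠ D := by rintro rfl; omega
  have hCD' : C' ≠ D' := by rintro rfl; omega
  obtain rfl : D = C' := ((h.eq_or_eq hC hD hC').resolve_left hCD).resolve_left hne
  obtain rfl : D' = C := ((h.eq_or_eq hC' hD' hC).resolve_left hCD').resolve_left (Ne.symm hne)
  omega

theorem IsTreelike.countable_walls [ProperSpace X] (h : IsTreelike 𝓑) : Countable (walls 𝓑) := by
  obtain ⟨d, hd, hsep⟩ := h.separating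
  have hne : ∀ W : walls 𝓑, ∃ x, x ∈ (W : Set X) := by
    rintro ⟨W, A, hA, B, hB, -, -, hW⟩
    exact hW
  choose f hf using hne
  refine Pairwise.countable_of_isOpen_disjoint (s := fun W => Metric.ball (f W) (d / 2))
    (fun V W hVW => ?_) (fun W => Metric.isOpen_ball) (fun W => ⟨f W, Metric.mem_ball_self (by linarith)⟩)
  refine Metric.ball_disjoint_ball ?_
  rw [add_halves]
  exact hsep V V.2 W W.2 (fun e => hVW (Subtype.ext e)) _ (hf V) _ (hf W)

/-- Each block other than the root is determined by the wall that it shares with its parent. -/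
theorem IsTreelike.countable [ProperSpace X] (h : IsTreelike 𝓑) : Countable 𝓑 := by
  have := h.countable_walls
  obtain ⟨r⟩ := h.isTree.connected.nonempty
  have hpar : ∀ C : {C : 𝓑 // C ≠ r}, ∃ D : 𝓑, (adjacencyGraph 𝓑).Adj D C.1 ∧
      rootPath h.isTree r C.1 = rootPath h.isTree r D ++ [C.1] :=
    fun C => exists_parent h.isTree C.2
  choose f hf hf' using hpar
  have hinj : Function.Injective (fun C : {C : 𝓑 // C ≠ r} => (⟨(f C : Set X) ∩ (C.1 : Set X),
      f C, (f C).2, C.1, C.1.2, fun e => (hf C).1 (Subtype.ext e), rfl, (hf C).2⟩ : walls 𝓑)) := by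
    intro C C' hCC
    have hCC' : (f C : Set X) ∩ (C.1 : Set X) = (f C' : Set X) ∩ (C'.1 : Set X) :=
      congrArg Subtype.val hCC
    obtain ⟨x, hx⟩ := (hf C).2
    have hx' := hx
    rw [hCC'] at hx'
    exact Subtype.ext (h.eq_of_mem_parent (hf' C) (hf' C') hx.2 hx.1 hx'.2 hx'.1)
  have : Countable {C : 𝓑 // C ≠ r} := hinj.countable
  have h1 : ({C : 𝓑 | C ≠ r}).Countable := Set.countable_coe_iff.1 this
  have h2 : (Set.univ : Set 𝓑).Countable := by
    refine ((Set.countable_singleton r).union h1).mono fun C _ => ?_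
    exact em (C = r)
  exact Set.countable_univ_iff.1 h2

/-- At most one wall meets the ball of radius `d / 2`; if it misses `x`, shrink the ball, as walls
are closed. -/
theorem IsTreelike.exists_ball_wall (h : IsTreelike 𝓑) (x : X) :
    ∃ ε > 0, ∀ W ∈ walls 𝓑, ∀ y ∈ Metric.ball x ε, y ∈ W → x ∈ W := by
  obtain ⟨d, hd, hsep⟩ := h.separating
  by_cases hex : ∃ W ∈ walls 𝓑, x ∉ W ∧ ∃ y ∈ Metric.ball x (d / 2), y ∈ W
  · obtain ⟨W, hW, hxW, y, hy, hyW⟩ := hex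
    obtain ⟨ε, hε, hball⟩ := Metric.isOpen_iff.1 (h.isClosed_wall hW).isOpen_compl x hxW
    refine ⟨min ε (d / 2), lt_min hε (by linarith), fun V hV z hz hzV => ?_⟩
    have hz1 := Metric.ball_subset_ball (min_le_left _ _) hz
    have hz2 := Metric.ball_subset_ball (min_le_right _ _) hz
    have hVW : V ≠ W := by
      rintro rfl
      exact hball hz1 hzV
    have := hsep V hV W hW hVW z hzV y hyW
    have := dist_triangle_right z y x
    rw [Metric.mem_ball] at hz2 hy
    linarith
  · push Not at hex
    refine ⟨d / 2, by linarith, fun W hW y hy hyW => ?_⟩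
    by_contra hxW
    exact hex W hW hxW y hy hyW

/-- Near a point there are only the blocks that contain it. -/
theorem IsTreelike.exists_ball_block [ProperSpace X] (hX : IsCAT0 X) (h : IsTreelike 𝓑) (x : X) :
    ∃ ε > 0, ∀ y ∈ Metric.ball x ε, ∀ A ∈ 𝓑, y ∈ A → x ∈ A := by
  obtain ⟨ε, hε, hball⟩ := h.exists_ball_wall x
  refine ⟨ε, hε, fun y hy A hA hyA => ?_⟩
  by_contra hxA
  obtain ⟨c, hc⟩ := hX.geodesic x y
  -- The segment is extended by constants to the whole line. Every wall that it meets contains `x`,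
  -- so the blocks without `x` are pairwise disjoint along `g` and disjoint there from the blocks
  -- with `x`.
  set g : ℝ → X := fun t => c (Set.projIcc 0 (dist x y) dist_nonneg t) with hg
  have hgc : Continuous g := by
    have := hc.continuousOn.domRestrict
    exact this.comp continuous_projIcc
  have hgball : ∀ t, g t ∈ Metric.ball x ε := fun t => by
    rw [Metric.mem_ball', hc.dist_left (Set.projIcc 0 (dist x y) dist_nonneg t).2]
    refine lt_of_le_of_lt (Set.projIcc 0 (dist x y) dist_nonneg t).2.2 ?_
    rwa [Metric.mem_ball'] at hy
  have hg0 : g 0 = x := by simp [hg, hc.source]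
  have hg1 : g (dist x y) = y := by simp [hg, hc.target]
  have htwo : ∀ t, ∀ B ∈ 𝓑, ∀ B' ∈ 𝓑, g t ∈ B → g t ∈ B' → B ≠ B' → x ∈ B ∧ x ∈ B' :=
    fun t B hB B' hB' h1 h2 hne =>
      hball _ (inter_mem_walls hB hB' hne h1 h2) _ (hgball t) ⟨h1, h2⟩
  have hfin : {B ∈ 𝓑 | x ∈ B}.Finite := by
    obtain ⟨A₀, hA₀⟩ := h.exists_mem x
    by_cases hex : ∃ B : 𝓑, B ≠ A₀ ∧ x ∈ (B : Set X)
    · obtain ⟨B₀, hne, hB₀⟩ := hex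
      refine (Set.toFinite {(A₀ : Set X), (B₀ : Set X)}).subset fun B hB => ?_
      rcases h.eq_or_eq (C := ⟨B, hB.1⟩) hA₀ hB₀ hB.2 with e | e | e
      · exact absurd e.symm hne
      · left; rw [e]
      · right; rw [e]; rfl
    · push Not at hex
      refine (Set.toFinite {(A₀ : Set X)}).subset fun B hB => ?_
      by_contra hne
      exact hex ⟨B, hB.1⟩ (fun e => hne (by rw [← e]; rfl)) hB.2
  have hK : IsClosed (⋃₀ {B ∈ 𝓑 | x ∈ B}) := by
    rw [Set.sUnion_eq_biUnion]
    exact hfin.isClosed_biUnion fun B hB => h.isClosed B hB.1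
  have := h.countable
  -- `none` stands for the union of the at most two blocks through `x`, which may overlap.
  set F : Option {B : 𝓑 // x ∉ (B : Set X)} → Set ℝ := fun i =>
    i.elim (g ⁻¹' ⋃₀ {B ∈ 𝓑 | x ∈ B}) (fun B => g ⁻¹' (B.1 : Set X)) with hF
  obtain ⟨i, hi⟩ := exists_eq_univ_of_countable_closed_partition F (by
      rintro (_ | B)
      · exact hK.preimage hgc
      · exact (h.isClosed _ B.1.2).preimage hgc) (by
      rintro (_ | B) (_ | B') t ht ht'
      · rfl
      · obtain ⟨C, ⟨hC, hxC⟩, htC⟩ := ht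
        exact absurd (htwo t C hC B'.1 B'.1.2 htC ht' (by rintro rfl; exact B'.2 hxC)).2 B'.2
      · obtain ⟨C, ⟨hC, hxC⟩, htC⟩ := ht'
        exact absurd (htwo t C hC B.1 B.1.2 htC ht (by rintro rfl; exact B.2 hxC)).2 B.2
      · by_contra hne
        exact B.2 (htwo t B.1 B.1.2 B'.1 B'.1.2 ht ht' fun e => hne
          (congrArg some (Subtype.ext (Subtype.ext e)))).1) (fun t => by
      obtain ⟨B, hB⟩ := h.exists_mem (g t)
      by_cases hxB : x ∈ (B : Set X)
      · exact ⟨none, B, ⟨B.2, hxB⟩, hB⟩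
      · exact ⟨some ⟨B, hxB⟩, hB⟩)
  rw [Set.eq_univ_iff_forall] at hi
  rcases i with _ | B
  · obtain ⟨C, ⟨hC, hxC⟩, hyC⟩ := hi (dist x y)
    rw [← hg1] at hyA
    exact hxA (htwo _ A hA C hC hyA hyC (by rintro rfl; exact hxA hxC)).1
  · have : g 0 ∈ (B.1 : Set X) := hi 0
    rw [hg0] at this
    exact B.2 this

theorem IsTreelike.isClosed_sUnion [ProperSpace X] (hX : IsCAT0 X) (h : IsTreelike 𝓑)
    {𝓢 : Set (Set X)} (h𝓢 : 𝓢 ⊆ 𝓑) : IsClosed (⋃₀ 𝓢) := by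
  rw [← isOpen_compl_iff, Metric.isOpen_iff]
  intro x hx
  obtain ⟨ε, hε, hball⟩ := h.exists_ball_block hX x
  refine ⟨ε, hε, fun y hy => ?_⟩
  rintro ⟨A, hA, hyA⟩
  exact hx ⟨A, hA, hball y hy A (h𝓢 hA) hyA⟩

/-- The union of the blocks beyond `C`, as seen from the root `r`. -/
def branch (h : IsTreelike 𝓑) (r C : 𝓑) : Set X :=
  ⋃₀ {B | ∃ hB : B ∈ 𝓑, rootPath h.isTree r C <+: rootPath h.isTree r ⟨B, hB⟩}

/-- The union of the blocks that are not beyond `C`, as seen from the root `r`. -/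
def cobranch (h : IsTreelike 𝓑) (r C : 𝓑) : Set X :=
  ⋃₀ {B | ∃ hB : B ∈ 𝓑, ¬ rootPath h.isTree r C <+: rootPath h.isTree r ⟨B, hB⟩}

theorem mem_branch {h : IsTreelike 𝓑} {r C : 𝓑} {x : X} : x ∈ branch h r C ↔
    ∃ B : 𝓑, rootPath h.isTree r C <+: rootPath h.isTree r B ∧ x ∈ (B : Set X) :=
  ⟨fun ⟨B, ⟨hB, hp⟩, hx⟩ => ⟨⟨B, hB⟩, hp, hx⟩, fun ⟨B, hp, hx⟩ => ⟨B, ⟨B.2, hp⟩, hx⟩⟩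

theorem mem_cobranch {h : IsTreelike 𝓑} {r C : 𝓑} {x : X} : x ∈ cobranch h r C ↔
    ∃ B : 𝓑, ¬ rootPath h.isTree r C <+: rootPath h.isTree r B ∧ x ∈ (B : Set X) :=
  ⟨fun ⟨B, ⟨hB, hp⟩, hx⟩ => ⟨⟨B, hB⟩, hp, hx⟩, fun ⟨B, hp, hx⟩ => ⟨B, ⟨B.2, hp⟩, hx⟩⟩

theorem mem_branch_or_mem_cobranch (h : IsTreelike 𝓑) (r C : 𝓑) (x : X) :
    x ∈ branch h r C ∨ x ∈ cobranch h r C := by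
  obtain ⟨B, hB⟩ := h.exists_mem x
  by_cases hp : rootPath h.isTree r C <+: rootPath h.isTree r B
  · exact Or.inl (mem_branch.2 ⟨B, hp, hB⟩)
  · exact Or.inr (mem_cobranch.2 ⟨B, hp, hB⟩)

theorem IsWallFree.prefix {h : IsTreelike 𝓑} {r C B : 𝓑} {x : X} (hx : IsWallFree 𝓑 x)
    (hB : x ∈ (B : Set X)) (hb : x ∈ branch h r C) :
    rootPath h.isTree r C <+: rootPath h.isTree r B := by
  obtain ⟨A, hA, hxA⟩ := mem_branch.1 hb
  rwa [hx.eq hB hxA]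

theorem IsWallFree.notMem_cobranch {h : IsTreelike 𝓑} {r C : 𝓑} {x : X} (hx : IsWallFree 𝓑 x)
    (hb : x ∈ branch h r C) : x ∉ cobranch h r C := by
  intro hc
  obtain ⟨A, hA, hxA⟩ := mem_cobranch.1 hc
  exact hA (hx.prefix hxA hb)

/-- A block beyond `C` and one not beyond `C` that share a point are adjacent, and the only tree
edge between the two sides joins `C` to its parent. -/
theorem mem_parent_of_mem_branch (h : IsTreelike 𝓑) {r C D : 𝓑} {x : X}
    (hp : rootPath h.isTree r C = rootPath h.isTree r D ++ [C]) (hb : x ∈ branch h r C)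
    (hc : x ∈ cobranch h r C) : x ∈ (C : Set X) ∩ (D : Set X) := by
  obtain ⟨A, hA, hxA⟩ := mem_branch.1 hb
  obtain ⟨B, hB, hxB⟩ := mem_cobranch.1 hc
  have hAB : A ≠ B := by rintro rfl; exact hB hA
  rcases rootPath_of_adj h.isTree r (show (adjacencyGraph 𝓑).Adj A B from ⟨hAB, x, hxA, hxB⟩)
    with e | e
  · exact absurd (hA.trans (e ▸ List.prefix_append _ _)) hB
  · rw [e, List.prefix_concat_iff, ← e] at hA
    obtain rfl := rootPath_injective h.isTree r (hA.resolve_right hB)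
    rw [hp] at e
    obtain rfl := rootPath_injective h.isTree r (List.append_cancel_right e)
    exact ⟨hxA, hxB⟩

theorem subset_branch (h : IsTreelike 𝓑) (r C : 𝓑) : (C : Set X) ⊆ branch h r C :=
  fun _ hx => mem_branch.2 ⟨C, List.prefix_rfl, hx⟩

theorem subset_cobranch {h : IsTreelike 𝓑} {r C D : 𝓑}
    (hp : rootPath h.isTree r C = rootPath h.isTree r D ++ [C]) :
    (D : Set X) ⊆ cobranch h r C := by
  refine fun _ hx => mem_cobranch.2 ⟨D, fun hpre => ?_, hx⟩
  have := hpre.length_le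
  rw [hp] at this
  simp at this

theorem isClosed_branch [ProperSpace X] (hX : IsCAT0 X) (h : IsTreelike 𝓑) (r C : 𝓑) :
    IsClosed (branch h r C) :=
  h.isClosed_sUnion hX fun _ hB => hB.1

theorem isClosed_cobranch [ProperSpace X] (hX : IsCAT0 X) (h : IsTreelike 𝓑) (r C : 𝓑) :
    IsClosed (cobranch h r C) :=
  h.isClosed_sUnion hX fun _ hB => hB.1

end Blocks
-- Itineraries of rays and the final contradiction.
section Rays

variable {X : Type*} [MetricSpace X] {𝓑 : Set (Set X)}

theorem rootPath_root_prefix (h : IsTreelike 𝓑) (r C : 𝓑) :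
    rootPath h.isTree r r <+: rootPath h.isTree r C := by
  obtain ⟨P, -, hP⟩ := exists_rootPath h.isTree r C
  rw [rootPath_self, hP, ← P.cons_tail_support]
  exact List.prefix_append [r] _

theorem rootPath_length_pos (h : IsTreelike 𝓑) (r C : 𝓑) : 0 < (rootPath h.isTree r C).length :=
  List.length_pos_of_ne_nil (rootPath_ne_nil h.isTree r C)

theorem eq_of_prefix_of_length_le (h : IsTreelike 𝓑) {r C D : 𝓑}
    (hp : rootPath h.isTree r C <+: rootPath h.isTree r D)
    (hl : (rootPath h.isTree r D).length ≤ (rootPath h.isTree r C).length) : C = D :=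
  rootPath_injective h.isTree r (hp.eq_of_length_le hl)

theorem IsWallFree.notMem_branch {h : IsTreelike 𝓑} {r C : 𝓑} {x : X} (hx : IsWallFree 𝓑 x)
    (hr : x ∈ (r : Set X)) (hC : C ≠ r) : x ∉ branch h r C := by
  intro hb
  refine hC (eq_of_prefix_of_length_le h (hx.prefix hr hb) ?_)
  rw [rootPath_self]
  exact rootPath_length_pos h r C

theorem IsWallFree.mem_cobranch {h : IsTreelike 𝓑} {r C : 𝓑} {x : X} (hx : IsWallFree 𝓑 x)
    (hr : x ∈ (r : Set X)) (hC : C ≠ r) : x ∈ cobranch h r C :=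
  (mem_branch_or_mem_cobranch h r C x).resolve_left (hx.notMem_branch hr hC)

variable {γ : ℝ≥0 → X} {r : 𝓑}

/-- Between two sides of a wall a ray crosses the wall. -/
theorem exists_crossing [ProperSpace X] (hX : IsCAT0 X) (h : IsTreelike 𝓑) (hγ : IsGeodesicRay γ)
    {C D : 𝓑} (hp : rootPath h.isTree r C = rootPath h.isTree r D ++ [C]) {s t a b : ℝ≥0}
    (ha : a ∈ Set.Icc s t) (hb : b ∈ Set.Icc s t) (hab : γ a ∈ branch h r C)
    (hbc : γ b ∈ cobranch h r C) : ∃ u ∈ Set.Icc s t, γ u ∈ (C : Set X) ∩ (D : Set X) := by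
  have hc : Continuous γ := Isometry.continuous hγ
  obtain ⟨u, hu, h1, h2⟩ := isPreconnected_closed_iff.1 (isPreconnected_Icc (a := s) (b := t))
    _ _ ((isClosed_branch hX h r C).preimage hc) ((isClosed_cobranch hX h r C).preimage hc)
    (fun u _ => mem_branch_or_mem_cobranch h r C (γ u)) ⟨a, ha, hab⟩ ⟨b, hb, hbc⟩
  exact ⟨u, hu, mem_parent_of_mem_branch h hp h1 h2⟩

theorem mem_inter_of_between (h : IsTreelike 𝓑) (hγ : IsGeodesicRay γ) (C D : 𝓑)
    {s t u : ℝ≥0} (hs : γ s ∈ (C : Set X) ∩ (D : Set X)) (ht : γ t ∈ (C : Set X) ∩ (D : Set X))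
    (hsu : s ≤ u) (hut : u ≤ t) : γ u ∈ (C : Set X) ∩ (D : Set X) :=
  ((h.convex C C.2).inter (h.convex D D.2)).mem_of_mem_ray hγ hs ht hsu hut

theorem branch_ordConnected [ProperSpace X] (hX : IsCAT0 X) (h : IsTreelike 𝓑)
    (hγ : IsGeodesicRay γ) {C : 𝓑} (hC : C ≠ r) {s t u : ℝ≥0} (hs : γ s ∈ branch h r C)
    (ht : γ t ∈ branch h r C) (hsu : s ≤ u) (hut : u ≤ t) : γ u ∈ branch h r C := by
  obtain ⟨D, -, hp⟩ := exists_parent h.isTree hC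
  by_contra hu
  have hu' := (mem_branch_or_mem_cobranch h r C (γ u)).resolve_left hu
  obtain ⟨a, ha, ha'⟩ := exists_crossing hX h hγ hp ⟨le_rfl, hsu⟩ ⟨hsu, le_rfl⟩ hs hu'
  obtain ⟨b, hb, hb'⟩ := exists_crossing hX h hγ hp ⟨hut, le_rfl⟩ ⟨le_rfl, hut⟩ ht hu'
  exact hu (subset_branch h r C (mem_inter_of_between h hγ C D ha' hb' ha.2 hb.1).1)

theorem cobranch_ordConnected [ProperSpace X] (hX : IsCAT0 X) (h : IsTreelike 𝓑)
    (hγ : IsGeodesicRay γ) {C : 𝓑} (hC : C ≠ r) {s t u : ℝ≥0} (hs : γ s ∈ cobranch h r C)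
    (ht : γ t ∈ cobranch h r C) (hsu : s ≤ u) (hut : u ≤ t) : γ u ∈ cobranch h r C := by
  obtain ⟨D, -, hp⟩ := exists_parent h.isTree hC
  by_contra hu
  have hu' := (mem_branch_or_mem_cobranch h r C (γ u)).resolve_right hu
  obtain ⟨a, ha, ha'⟩ := exists_crossing hX h hγ hp ⟨hsu, le_rfl⟩ ⟨le_rfl, hsu⟩ hu' hs
  obtain ⟨b, hb, hb'⟩ := exists_crossing hX h hγ hp ⟨le_rfl, hut⟩ ⟨hut, le_rfl⟩ hu' ht
  exact hu (subset_cobranch hp (mem_inter_of_between h hγ C D ha' hb' ha.2 hb.1).2)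

/-- A ray that has passed a wall does not come back. -/
theorem notMem_cobranch_of_le [ProperSpace X] (hX : IsCAT0 X) (h : IsTreelike 𝓑)
    (hγ : IsGeodesicRay γ) (h0 : IsWallFree 𝓑 (γ 0)) (hr : γ 0 ∈ (r : Set X)) {C : 𝓑}
    (hC : C ≠ r) {s t : ℝ≥0} (hs : γ s ∉ cobranch h r C) (hst : s ≤ t) :
    γ t ∉ cobranch h r C :=
  fun ht => hs (cobranch_ordConnected hX h hγ hC (h0.mem_cobranch hr hC) ht (zero_le (a := s)) hst)

/-- Off the walls a point of `A` is not on the near side of `A`, and the ray never returns there. -/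
theorem prefix_of_le [ProperSpace X] (hX : IsCAT0 X) (h : IsTreelike 𝓑)
    (hγ : IsGeodesicRay γ) (h0 : IsWallFree 𝓑 (γ 0)) (hr : γ 0 ∈ (r : Set X)) {A B : 𝓑}
    {s t : ℝ≥0} (hs : IsWallFree 𝓑 (γ s)) (hA : γ s ∈ (A : Set X)) (hB : γ t ∈ (B : Set X))
    (hst : s ≤ t) : rootPath h.isTree r A <+: rootPath h.isTree r B := by
  by_cases hAr : A = r
  · rw [hAr]; exact rootPath_root_prefix h r B
  · have h1 := notMem_cobranch_of_le hX h hγ h0 hr hAr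
      (hs.notMem_cobranch (subset_branch h r A hA)) hst
    by_contra hcon
    exact h1 (mem_cobranch.2 ⟨B, hcon, hB⟩)

theorem exists_wallFree_between (h : IsTreelike 𝓑) (hγ : IsGeodesicRay γ) {W : Set X}
    (hW : W ∈ walls 𝓑) {s t : ℝ≥0} (hst : s ≤ t) (hs : γ s ∈ W) (ht : γ t ∉ W) :
    ∃ u ∈ Set.Icc s t, IsWallFree 𝓑 (γ u) := by
  obtain ⟨d, hd, hsep⟩ := h.separating
  have hcl : IsClosed (γ ⁻¹' W) := (h.isClosed_wall hW).preimage (Isometry.continuous hγ)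
  obtain ⟨m, ⟨hm, hmW⟩, hmax⟩ := (isCompact_Icc.inter_right hcl).exists_isGreatest ⟨s, ⟨le_rfl, hst⟩, hs⟩
  have hmt : m < t := lt_of_le_of_ne hm.2 (by rintro rfl; exact ht hmW)
  -- Shortly after the last time `m` in `W`: any other wall is at distance at least `d` from `γ m`.
  set u : ℝ≥0 := min t (m + ⟨d / 2, by linarith⟩) with hu
  have hmu : m < u := lt_min hmt (by
    show (m : ℝ) < m + d / 2
    linarith)
  have hud : (u : ℝ) ≤ m + d / 2 := (min_le_right _ _ : u ≤ m + ⟨d / 2, by linarith⟩)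
  have hmu' : (m : ℝ) < u := hmu
  refine ⟨u, ⟨hm.1.trans hmu.le, min_le_left _ _⟩, fun V hV huV => ?_⟩
  by_cases hVW : V = W
  · subst hVW
    exact absurd (hmax ⟨⟨hm.1.trans hmu.le, min_le_left _ _⟩, huV⟩) (not_le_of_gt hmu)
  · have := hsep V hV W hW hVW _ huV _ hmW
    rw [hγ.dist_eq, abs_of_pos (by linarith)] at this
    linarith

theorem HasInfiniteItinerary.exists_wallFree (h : IsTreelike 𝓑) (hγ : IsGeodesicRay γ)
    (hI : HasInfiniteItinerary 𝓑 γ) (s : ℝ≥0) : ∃ t, s ≤ t ∧ IsWallFree 𝓑 (γ t) := by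
  by_cases hs : IsWallFree 𝓑 (γ s)
  · exact ⟨s, le_rfl, hs⟩
  · unfold IsWallFree at hs
    push Not at hs
    obtain ⟨W, hW, hsW⟩ := hs
    have hleave : ∃ t, s ≤ t ∧ γ t ∉ W := by
      by_contra! hcon
      obtain ⟨A, hA, B, -, -, rfl, -⟩ := hW
      exact hI ⟨A, hA, s, fun t ht => (hcon t ht).1⟩
    obtain ⟨t, hst, ht⟩ := hleave
    obtain ⟨u, hu, hu'⟩ := exists_wallFree_between h hγ hW hst hsW ht
    exact ⟨u, hu.1, hu'⟩

theorem exists_pos_wallFree [ProperSpace X] (hX : IsCAT0 X) (h : IsTreelike 𝓑)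
    (hγ : IsGeodesicRay γ) (h0 : IsWallFree 𝓑 (γ 0)) (hr : γ 0 ∈ (r : Set X)) :
    ∃ s, 0 < s ∧ IsWallFree 𝓑 (γ s) ∧ γ s ∈ (r : Set X) := by
  obtain ⟨ε₁, hε₁, hw⟩ := h.exists_ball_wall (γ 0)
  obtain ⟨ε₂, hε₂, hb⟩ := h.exists_ball_block hX (γ 0)
  set s : ℝ≥0 := ⟨min ε₁ ε₂ / 2, by positivity⟩ with hs
  have hpos : 0 < min ε₁ ε₂ := lt_min hε₁ hε₂
  have hs0 : 0 < (s : ℝ) := half_pos hpos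
  have hd : dist (γ s) (γ 0) < min ε₁ ε₂ := by
    rw [hγ.dist_eq, NNReal.coe_zero, sub_zero, abs_of_pos hs0]
    exact half_lt_self hpos
  refine ⟨s, hs0, fun W hW hsW => h0 W hW (hw W hW _ (hd.trans_le (min_le_left _ _)) hsW), ?_⟩
  obtain ⟨B, hB⟩ := h.exists_mem (γ s)
  have := hb _ (hd.trans_le (min_le_right _ _)) B B.2 hB
  rwa [h0.eq hr this]

/-- A ray meets every block on the way to a block that it visits in a point off the walls. -/
theorem exists_visit [ProperSpace X] (hX : IsCAT0 X) (h : IsTreelike 𝓑)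
    (hγ : IsGeodesicRay γ) (h0 : IsWallFree 𝓑 (γ 0)) (hr : γ 0 ∈ (r : Set X)) {B C : 𝓑}
    {t : ℝ≥0} (ht : IsWallFree 𝓑 (γ t)) (hB : γ t ∈ (B : Set X))
    (hCB : rootPath h.isTree r C <+: rootPath h.isTree r B) :
    ∃ s, 0 < s ∧ IsWallFree 𝓑 (γ s) ∧ γ s ∈ (C : Set X) := by
  by_cases hCr : C = r
  · rw [hCr]; exact exists_pos_wallFree hX h hγ h0 hr
  by_cases hCB' : C = B
  · subst hCB'
    refine ⟨t, pos_iff_ne_zero.2 ?_, ht, hB⟩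
    rintro rfl
    exact hCr (h0.eq hB hr)
  have hlt : (rootPath h.isTree r C).length < (rootPath h.isTree r B).length := by
    by_contra! hcon
    exact hCB' (eq_of_prefix_of_length_le h hCB hcon)
  -- `D` is the child of `C` towards `B`. The ray enters `C` through the wall with the parent `E`
  -- and leaves through the wall with `D`; a time off the walls in between lies in `C`.
  obtain ⟨D, hDB, hDlen⟩ := exists_ancestor h.isTree r _ B hlt
  have hDr : D ≠ r := by
    rintro rfl
    rw [rootPath_self, List.length_singleton] at hDlen
    have := rootPath_length_pos h D C
    omega
  obtain ⟨D', -, hD⟩ := exists_parent h.isTree hDr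
  obtain rfl : D' = C := by
    have hlen := congrArg List.length hD
    rw [List.length_append, List.length_singleton] at hlen
    refine eq_of_prefix_of_length_le h (List.prefix_of_prefix_length_le
      ((hD ▸ List.prefix_append _ _ : rootPath h.isTree r D' <+: rootPath h.isTree r D).trans hDB)
      hCB (by omega)) (by omega)
  obtain ⟨E, -, hC⟩ := exists_parent h.isTree hCr
  have htC : γ t ∈ branch h r D' := mem_branch.2 ⟨B, hCB, hB⟩
  have htD : γ t ∈ branch h r D := mem_branch.2 ⟨B, hDB, hB⟩
  obtain ⟨s₁, hs₁, hs₁'⟩ := exists_crossing hX h hγ hC ⟨zero_le (a := t), le_rfl⟩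
    ⟨le_rfl, zero_le (a := t)⟩ htC (h0.mem_cobranch hr hCr)
  obtain ⟨s₂, hs₂, hs₂'⟩ := exists_crossing hX h hγ hD ⟨zero_le (a := t), le_rfl⟩
    ⟨le_rfl, zero_le (a := t)⟩ htD (h0.mem_cobranch hr hDr)
  have hCne : D' ≠ D := by rintro rfl; omega
  have hs₂E : γ s₂ ∉ (D' : Set X) ∩ (E : Set X) := fun hcon =>
    hCne (h.eq_of_mem_parent hC hD hcon.1 hcon.2 hs₂'.1 hs₂'.2)
  have hs₂C := subset_branch h r D' hs₂'.2
  have hle : s₁ ≤ s₂ := by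
    by_contra! hlt
    exact notMem_cobranch_of_le hX h hγ h0 hr hCr
      (fun hco => hs₂E (mem_parent_of_mem_branch h hC hs₂C hco)) hlt.le (subset_cobranch hC hs₁'.2)
  have hCE : (D' : Set X) ≠ E := by
    intro e
    have := congrArg List.length hC
    rw [← Subtype.ext e] at this
    simp at this
  obtain ⟨u, hu, hu'⟩ := exists_wallFree_between h hγ
    (inter_mem_walls D'.2 E.2 hCE hs₁'.1 hs₁'.2) hle hs₁' hs₂E
  obtain ⟨A, hA⟩ := h.exists_mem (γ u)
  have hCA := hu'.prefix hA (branch_ordConnected hX h hγ hCr (subset_branch h r D' hs₁'.1) hs₂C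
    hu.1 hu.2)
  have hAB := prefix_of_le hX h hγ h0 hr hu' hA hB (hu.2.trans hs₂.2)
  have hDA : ¬ rootPath h.isTree r D <+: rootPath h.isTree r A := fun hcon =>
    notMem_cobranch_of_le hX h hγ h0 hr hDr
      (hu'.notMem_cobranch (mem_branch.2 ⟨A, hcon, hA⟩)) hu.2 (subset_cobranch hD hs₂'.2)
  have hAlen : (rootPath h.isTree r A).length < (rootPath h.isTree r D).length := by
    by_contra! hcon
    exact hDA (List.prefix_of_prefix_length_le hDB hAB hcon)
  obtain rfl := eq_of_prefix_of_length_le h hCA (by omega)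
  refine ⟨u, pos_iff_ne_zero.2 ?_, hu', hA⟩
  rintro rfl
  exact hCr (h0.eq hA hr)

theorem HasInfiniteItinerary.exists_deep [ProperSpace X] (hX : IsCAT0 X) (h : IsTreelike 𝓑)
    (hγ : IsGeodesicRay γ) (h0 : IsWallFree 𝓑 (γ 0)) (hr : γ 0 ∈ (r : Set X))
    (hI : HasInfiniteItinerary 𝓑 γ) (n : ℕ) :
    ∃ t, IsWallFree 𝓑 (γ t) ∧ ∃ B : 𝓑, γ t ∈ (B : Set X) ∧
      n < (rootPath h.isTree r B).length := by
  induction n with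
  | zero => exact ⟨0, h0, r, hr, rootPath_length_pos h r r⟩
  | succ n ih =>
    obtain ⟨t, ht, B, hB, hn⟩ := ih
    have hleave : ∃ t', t ≤ t' ∧ γ t' ∉ (B : Set X) := by
      by_contra! hcon
      exact hI ⟨B, B.2, t, hcon⟩
    obtain ⟨t', htt', ht'⟩ := hleave
    obtain ⟨u, hu, hu'⟩ := hI.exists_wallFree h hγ t'
    obtain ⟨A, hA⟩ := h.exists_mem (γ u)
    refine ⟨u, hu', A, hA, lt_of_le_of_lt (Nat.succ_le_of_lt hn) ?_⟩
    by_contra! hcon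
    obtain rfl := eq_of_prefix_of_length_le h
      (prefix_of_le hX h hγ h0 hr ht hB hA (htt'.trans hu)) hcon
    -- Without a gain in depth the ray would be back in `B`, and convexity forbids leaving it in
    -- between.
    exact ht' ((h.convex B B.2).mem_of_mem_ray hγ hB hA htt' hu)

theorem isWallFree_of_mem_openBlock (h : IsTreelike 𝓑) {x : X} {B : 𝓑}
    (hx : x ∈ openBlock 𝓑 (B : Set X)) : IsWallFree 𝓑 x := by
  intro W hW hxW
  refine hx.2 ⟨W, ⟨hW, ?_⟩, hxW⟩
  obtain ⟨A, hA, C, hC, hne, rfl, -⟩ := hW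
  rcases h.eq_or_eq (A := ⟨A, hA⟩) (B := ⟨C, hC⟩) hxW.1 hxW.2 hx.1 with e | e | e
  · exact absurd (congrArg Subtype.val e) hne
  · rw [← e]; exact Set.inter_subset_left
  · rw [← e]; exact Set.inter_subset_right

/-- A sequence of blocks that a ray visits off the walls and that have increasing distance from the
first one is the itinerary of the ray. -/
theorem isInfiniteItinerary_of_visits [ProperSpace X] (hX : IsCAT0 X) (h : IsTreelike 𝓑)
    (hγ : IsGeodesicRay γ) (h0 : IsWallFree 𝓑 (γ 0)) (hI : HasInfiniteItinerary 𝓑 γ)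
    {I : ℕ → 𝓑} (hr : γ 0 ∈ (I 0 : Set X))
    (hvis : ∀ i, ∃ s, 0 < s ∧ IsWallFree 𝓑 (γ s) ∧ γ s ∈ (I i : Set X))
    (hlen : ∀ i, (rootPath h.isTree (I 0) (I i)).length = i + 1) :
    IsInfiniteItinerary 𝓑 γ I := by
  choose s hs0 hsw hsI using hvis
  have hmono : ∀ i, s i < s (i + 1) := fun i => by
    by_contra! hcon
    have := (prefix_of_le hX h hγ h0 hr (hsw _) (hsI (i + 1)) (hsI i) hcon).length_le
    rw [hlen, hlen] at this
    omega
  have hsupp : ∀ i, rootPath h.isTree (I 0) (I i) = (List.range (i + 1)).map I := by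
    intro i
    induction i with
    | zero => rw [rootPath_self]; rfl
    | succ i ih =>
      have hne : I (i + 1) ≠ I 0 := fun e => by
        have := hlen (i + 1)
        rw [e, rootPath_self, List.length_singleton] at this
        omega
      obtain ⟨D, -, hD⟩ := exists_parent h.isTree hne
      have hl := congrArg List.length hD
      rw [List.length_append, List.length_singleton, hlen] at hl
      have hpre := prefix_of_le hX h hγ h0 hr (hsw i) (hsI i) (hsI (i + 1)) (hmono i).le
      obtain rfl : I i = D := eq_of_prefix_of_length_le h
        (List.prefix_of_prefix_length_le hpre (hD ▸ List.prefix_append _ _)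
          (by rw [hlen]; omega)) (by rw [hlen]; omega)
      rw [hD, ih, List.range_succ (n := i + 1), List.map_append]
      rfl
  -- The visiting times are shifted by one, as time `0` comes first; this is why visits must have
  -- positive times.
  refine ⟨hI, fun n => Nat.casesOn n 0 s, rfl, strictMono_nat_of_lt_succ fun n => ?_, fun i => ?_⟩
  · cases n with
    | zero => exact hs0 0
    | succ n => exact hmono n
  · obtain ⟨P, hP, hPs⟩ := exists_rootPath h.isTree (I 0) (I i)
    refine ⟨(hsw i).mem_openBlock (hsI i), P, ⟨hr, hsI i, hP, ?_⟩, by rw [← hPs, hsupp]⟩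
    intro C' Q hC' hQ
    obtain rfl := (hsw i).eq (hsI i) hC'
    have : P.support.length = Q.support.length := by rw [← hPs, rootPath_eq h.isTree hQ]
    simp only [SimpleGraph.Walk.length_support] at this
    omega

theorem HasInfiniteItinerary.exists_itinerary [ProperSpace X] (hX : IsCAT0 X) (h : IsTreelike 𝓑)
    (hγ : IsGeodesicRay γ) (h0 : IsWallFree 𝓑 (γ 0)) (hI : HasInfiniteItinerary 𝓑 γ) :
    ∃ I, IsInfiniteItinerary 𝓑 γ I := by
  obtain ⟨r, hr⟩ := h.exists_mem (γ 0)
  have hvis : ∀ i, ∃ C : 𝓑, (rootPath h.isTree r C).length = i + 1 ∧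
      ∃ s, 0 < s ∧ IsWallFree 𝓑 (γ s) ∧ γ s ∈ (C : Set X) := by
    intro i
    obtain ⟨t, ht, B, hB, hn⟩ := hI.exists_deep hX h hγ h0 hr i
    obtain ⟨C, hCB, hC⟩ := exists_ancestor h.isTree r i B hn
    exact ⟨C, hC, exists_visit hX h hγ h0 hr ht hB hCB⟩
  choose I hlen hvis using hvis
  obtain rfl : r = I 0 := eq_of_prefix_of_length_le h (rootPath_root_prefix h r (I 0)) (by
    rw [hlen]; exact rootPath_length_pos h r r)
  exact ⟨I, isInfiniteItinerary_of_visits hX h hγ h0 hI hr hvis hlen⟩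

theorem IsInfiniteItinerary.visits (h : IsTreelike 𝓑) (h0 : IsWallFree 𝓑 (γ 0))
    (hr : γ 0 ∈ (r : Set X)) {I : ℕ → 𝓑} (hI : IsInfiniteItinerary 𝓑 γ I) (i : ℕ) :
    (∃ s, IsWallFree 𝓑 (γ s) ∧ γ s ∈ (I i : Set X)) ∧
      rootPath h.isTree r (I i) = (List.range (i + 1)).map I := by
  obtain ⟨-, t, -, -, ht⟩ := hI
  obtain ⟨hti, P, hP, hPs⟩ := ht i
  obtain rfl := h0.eq hr hP.source_mem
  exact ⟨⟨_, isWallFree_of_mem_openBlock h hti, hti.1⟩, by rw [rootPath_eq h.isTree hP.isPath, hPs]⟩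

theorem IsInfiniteItinerary.eq [ProperSpace X] (hX : IsCAT0 X) (h : IsTreelike 𝓑)
    (hγ : IsGeodesicRay γ) (h0 : IsWallFree 𝓑 (γ 0)) {I J : ℕ → 𝓑}
    (hI : IsInfiniteItinerary 𝓑 γ I) (hJ : IsInfiniteItinerary 𝓑 γ J) : I = J := by
  obtain ⟨r, hr⟩ := h.exists_mem (γ 0)
  funext i
  obtain ⟨⟨s, hs, hsI⟩, hli⟩ := hI.visits h h0 hr i
  obtain ⟨⟨t, ht, htJ⟩, hlj⟩ := hJ.visits h h0 hr i
  rcases le_total s t with hst | hst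
  · exact eq_of_prefix_of_length_le h (prefix_of_le hX h hγ h0 hr hs hsI htJ hst)
      (by rw [hli, hlj]; simp)
  · exact (eq_of_prefix_of_length_le h (prefix_of_le hX h hγ h0 hr ht htJ hsI hst)
      (by rw [hli, hlj]; simp)).symm

theorem IsInfiniteItinerary.exists_mem_wall [ProperSpace X] (hX : IsCAT0 X) (h : IsTreelike 𝓑)
    (hγ : IsGeodesicRay γ) (h0 : IsWallFree 𝓑 (γ 0)) {I : ℕ → 𝓑}
    (hI : IsInfiniteItinerary 𝓑 γ I) (i : ℕ) :
    ∃ s, γ s ∈ (I (i + 1) : Set X) ∩ (I i : Set X) := by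
  obtain ⟨r, hr⟩ := h.exists_mem (γ 0)
  obtain ⟨⟨t, -, htI⟩, hl⟩ := hI.visits h h0 hr (i + 1)
  have hp : rootPath h.isTree r (I (i + 1)) = rootPath h.isTree r (I i) ++ [I (i + 1)] := by
    rw [hl, (hI.visits h h0 hr i).2, List.range_succ (n := i + 1), List.map_append]
    rfl
  have hne : I (i + 1) ≠ r := by
    intro e
    rw [e, rootPath_self] at hl
    simpa using congrArg List.length hl
  obtain ⟨s, -, hs⟩ := exists_crossing hX h hγ hp ⟨zero_le (a := t), le_rfl⟩
    ⟨le_rfl, zero_le (a := t)⟩ (subset_branch h r _ htI) (h0.mem_cobranch hr hne)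
  exact ⟨s, hs⟩

/-- No ball meets infinitely many of the walls that a ray crosses. -/
theorem IsInfiniteItinerary.false_of_bounded [ProperSpace X] (h : IsTreelike 𝓑)
    (h0 : IsWallFree 𝓑 (γ 0)) {I : ℕ → 𝓑} (hI : IsInfiniteItinerary 𝓑 γ I) {p : X} {ρ : ℝ}
    (w : ℕ → X) (hw : ∀ i, w i ∈ (I (i + 1) : Set X) ∩ (I i : Set X))
    (hρ : ∀ i, dist p (w i) ≤ ρ) : False := by
  obtain ⟨d, hd, hsep⟩ := h.separating
  obtain ⟨r, hr⟩ := h.exists_mem (γ 0)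
  have hlen : ∀ i, (rootPath h.isTree r (I i)).length = i + 1 := fun i => by
    rw [(hI.visits h h0 hr i).2]; simp
  have hp : ∀ i, rootPath h.isTree r (I (i + 1)) = rootPath h.isTree r (I i) ++ [I (i + 1)] := by
    intro i
    rw [(hI.visits h h0 hr (i + 1)).2, (hI.visits h h0 hr i).2, List.range_succ (n := i + 1),
      List.map_append]
    rfl
  have hwall : ∀ i, (I (i + 1) : Set X) ∩ (I i : Set X) ∈ walls 𝓑 := fun i => by
    refine inter_mem_walls (I (i + 1)).2 (I i).2 (fun e => ?_) (hw i).1 (hw i).2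
    have := hlen (i + 1)
    rw [Subtype.ext e, hlen] at this
    omega
  have hfar : ∀ i j, i ≠ j → d ≤ dist (w i) (w j) := by
    intro i j hij
    refine hsep _ (hwall i) _ (hwall j) (fun e => hij ?_) _ (hw i) _ (hw j)
    have hj := hw i
    rw [e] at hj
    have := hlen (i + 1)
    rw [h.eq_of_mem_parent (hp i) (hp j) (hw i).1 (hw i).2 hj.1 hj.2, hlen] at this
    omega
  obtain ⟨a, -, φ, hφ, hlim⟩ := (isCompact_closedBall p ρ).tendsto_subseq
    (x := w) (fun i => by rw [Metric.mem_closedBall, dist_comm]; exact hρ i)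
  obtain ⟨N, hN⟩ := Metric.cauchySeq_iff.1 hlim.cauchySeq d hd
  -- A convergent subsequence would contain two points closer than `d` in different walls.
  exact absurd (hN N le_rfl (N + 1) (Nat.le_succ N)) (not_lt_of_ge
    (hfar _ _ (hφ.injective.ne (Nat.succ_ne_self N).symm)))

theorem IsMorse.itinerary_ne [ProperSpace X] (hX : IsCAT0 X) (h : IsTreelike 𝓑) {α β : ℝ≥0 → X}
    (hα : IsGeodesicRay α) (hβ : IsGeodesicRay β) (h0 : α 0 = β 0) (hw : IsWallFree 𝓑 (α 0))
    (hne : α ≠ β) (hM : IsMorse α) {I J : ℕ → 𝓑} (hI : IsInfiniteItinerary 𝓑 α I)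
    (hJ : IsInfiniteItinerary 𝓑 β J) : I ≠ J := by
  rintro rfl
  obtain ⟨M, hM⟩ := hM
  obtain ⟨ρ, hρ⟩ := hM.exists_bound hX hα hβ h0 hne
  have hpt : ∀ i, ∃ x, x ∈ (I (i + 1) : Set X) ∩ (I i : Set X) ∧ dist (α 0) x ≤ ρ := by
    intro i
    obtain ⟨s, hs⟩ := hI.exists_mem_wall hX h hα hw i
    obtain ⟨v, hv⟩ := hJ.exists_mem_wall hX h hβ (h0 ▸ hw) i
    obtain ⟨c, hc⟩ := hX.geodesic (α s) (β v)
    obtain ⟨τ, hτ, hle⟩ := hρ s v c hc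
    exact ⟨c τ, ((h.convex _ (I (i + 1)).2).inter (h.convex _ (I i).2)) _ hs _ hv c hc τ hτ, hle⟩
  choose w hwI hwρ using hpt
  exact hI.false_of_bounded h hw w hwI hwρ

end Rays
end BlockDecomp

/-- Loneliness property: both itineraries are well defined infinite paths, and they differ. -/
theorem proposition4p7 {X : Type*} [MetricSpace X] [ProperSpace X] (hX : BlockDecomp.IsCAT0 X)
    (𝓑 : Set (Set X)) (h𝓑 : BlockDecomp.IsTreelike 𝓑)
    (p : X) (hp : ∀ W ∈ BlockDecomp.walls 𝓑, p ∉ W)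
    (α β : ℝ≥0 → X) (hα : BlockDecomp.IsGeodesicRay α) (hβ : BlockDecomp.IsGeodesicRay β)
    (hα0 : α 0 = p) (hβ0 : β 0 = p) (hαβ : α ≠ β)
    (hαI : BlockDecomp.HasInfiniteItinerary 𝓑 α) (hβI : BlockDecomp.HasInfiniteItinerary 𝓑 β)
    (hMorse : BlockDecomp.IsMorse α ∨ BlockDecomp.IsMorse β) :
    (∃! I : ℕ → 𝓑, BlockDecomp.IsInfiniteItinerary 𝓑 α I) ∧
    (∃! J : ℕ → 𝓑, BlockDecomp.IsInfiniteItinerary 𝓑 β J) ∧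
    ∀ I J : ℕ → 𝓑, BlockDecomp.IsInfiniteItinerary 𝓑 α I →
      BlockDecomp.IsInfiniteItinerary 𝓑 β J → I ≠ J := by
  have hwα : BlockDecomp.IsWallFree 𝓑 (α 0) := hα0 ▸ hp
  have hwβ : BlockDecomp.IsWallFree 𝓑 (β 0) := hβ0 ▸ hp
  have h0 : α 0 = β 0 := hα0.trans hβ0.symm
  refine ⟨?_, ?_, fun I J hI hJ => ?_⟩
  · obtain ⟨I, hI⟩ := hαI.exists_itinerary hX h𝓑 hα hwα
    exact ⟨I, hI, fun J hJ => hJ.eq hX h𝓑 hα hwα hI⟩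
  · obtain ⟨J, hJ⟩ := hβI.exists_itinerary hX h𝓑 hβ hwβ
    exact ⟨J, hJ, fun I hI => hI.eq hX h𝓑 hβ hwβ hJ⟩
  · rcases hMorse with hM | hM
    · exact hM.itinerary_ne hX h𝓑 hα hβ h0 hwα hαβ hI hJ
    · exact (hM.itinerary_ne hX h𝓑 hβ hα h0.symm hwβ hαβ.symm hJ hI).symm
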